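/- Let $Q=(I,H)$ be a finite acyclic quiver of affine type, $k=\mathbb{F}_q$ a finite field and $v_q=\sqrt q\in\mathbb{C}$. Let $\langle x,y\rangle=\sum_{i\in I}x_iy_i-\sum_{h:i\to j\text{ in }H}x_iy_j$ be the Euler form, let $\delta\in\mathbb{N}I$ be the minimal imaginary positive root, and put $|\delta|=\sum_i\delta_i$. The (twisted) Ringel–Hall algebra $\mathcal{H}^*(kQ)$ is the $\mathbb{Q}(v_q)$-space with basis the symbols $u_{[M]}$, for $[M]$ the isomorphism classes of finite-dimensional representations of $Q$ over $k$, and with product $$u_{[M]}*u_{[N]}=v_q^{\langle\underline{\dim}M,\underline{\dim}N\rangle}\sum_{[L]}g^L_{MN}\,u_{[L]},$$ where $g^L_{MN}$ is the number of subrepresentations $W\subseteq L$ with $W\cong N$ and $L/W\cong M$; its unit is $u_{[0]}$. Let $\mathcal{R}_{\rm h}$ be the category of homogeneous regular representations, i.e. of finite direct sums of representations lying in homogeneous tubes. Each homogeneous tube $z$ contains, up to isomorphism, exactly one regular simple representation $M((1),z)$; its dimension vector is $d\delta$ for some $d\ge 1$, and $\deg z=d$ is called the degree of $z$. For $m\ge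 0$ put $$H_m=\sum_{[M]:\,M\in\mathcal{R}_{\rm h},\ \underline{\dim}M=m\delta}v_q^{-\dim M}u_{[M]}$$ (so $H_0=1$), and $H_m=0$ for $m<0$; the elements $H_m$ commute with each other. For a partition $\lambda=(\lambda_1\ge\dots\ge\lambda_s)$ put $$H_\lambda=H_{\lambda_1}*\cdots*H_{\lambda_s},\qquad S_\lambda=\det\bigl(H_{\lambda_a-a+b}\bigr)_{1\le a,b\le s},$$ and let $A_\lambda^{[M]}$ and $B_\lambda^{[M]}$ be the coefficients of $u_{[M]}$ in $H_\lambda$ and in $S_\lambda$ respectively. Let $\lambda$ and $\mu=(\mu_1\ge\dots\ge\mu_l)$ be partitions with $|\lambda|=|\mu|$, let $z'_1,\dots,z'_l$ be pairwise distinct homogeneous tubes with $\deg z'_j=\mu_j$ for all $j$, and put $$M[\mu,\underline z']=M((1),z'_1)\oplus\cdots\oplus M((1),z'_l).$$ Then $$A_\lambda^{[M[\mu,\underline z']]}=v_q^{-|\lambda||\delta|}\,t'_\lambda(\mu)\qquad\text{and}\qquad B_\lambda^{[M[\mu,\underline z']]}=v_q^{-|\lambda||\delta|}\,t_\lambda(\mu),$$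 where $t'_\lambda(\mu)$ and $t_\lambda(\mu)$ are the values, at the elements of cycle type $\mu$ of the symmetric group $\mathfrak{S}_{|\lambda|}$, of the characters of the permutation module $M^\lambda$ (the complex vector space with basis the $\lambda$-tabloids) and of the Specht module $S^\lambda\subseteq M^\lambda$ (the span of the polytabloids) respectively. -/

import Mathlib

universe u v w

open scoped BigOperators

noncomputable section

namespace AffineHall

/-! ### Quivers, Euler form, affine type -/

section Euler

variable (I : Type v) [Fintype I] [Quiver.{w + 1} I] [∀ i j : I, Fintype (i ⟶ j)]

/-- The Euler form `⟨x, y⟩ = ∑_i x_i y_i - ∑_{h : i ⟶ j} x_i y_j` on `ℤI`. -/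
def eulerForm (x y : I → ℤ) : ℤ :=
  ∑ i, x i * y i - ∑ i, ∑ j, ∑ _h : i ⟶ j, x i * y j

/-- The Euler form on `ℕI`. -/
def eulerFormNat (x y : I → ℕ) : ℤ :=
  eulerForm I (fun i => (x i : ℤ)) (fun i => (y i : ℤ))

/-- A finite quiver is an acyclic quiver of affine type (an orientation without oriented cycles of
an extended Dynkin diagram) if it has no oriented cycle, its underlying graph is connected, and its
quadratic form `⟨x, x⟩` is positive semidefinite but not positive definite. -/
structure IsAcyclicAffine : Prop where
  acyclic : ∀ (i : I) (p : Quiver.Path i i), p.length = 0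
  connected : Subsingleton (Quiver.WeaklyConnectedComponent I)
  semidefinite : ∀ x : I → ℤ, 0 ≤ eulerForm I x x
  not_definite : ∃ x : I → ℤ, x ≠ 0 ∧ eulerForm I x x = 0

/-- `δ` is the minimal imaginary positive root. -/
def IsMinimalImaginaryRoot (δ : I → ℕ) : Prop :=
  IsLeast {x : I → ℕ | x ≠ 0 ∧ eulerFormNat I x x = 0} δ

end Euler

/-! ### Finite-dimensional representations -/

/-- A finite-dimensional representation of the quiver `I` over the field `k`. -/
structure QRep (k : Type u) [Field k] (I : Type v) [Quiver.{w + 1} I] where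
  V : I → Type u
  [grp : ∀ i, AddCommGroup (V i)]
  [mod : ∀ i, Module k (V i)]
  [fin : ∀ i, Module.Finite k (V i)]
  map : ∀ {i j : I}, (i ⟶ j) → V i →ₗ[k] V j

attribute [instance] QRep.grp QRep.mod QRep.fin

namespace QRep

variable {k : Type u} [Field k] {I : Type v} [Quiver.{w + 1} I]

/-- Isomorphism of representations. -/
def Iso (M N : QRep k I) : Prop :=
  ∃ f : ∀ i, M.V i ≃ₗ[k] N.V i,
    ∀ (i j : I) (h : i ⟶ j) (x : M.V i), f j (M.map h x) = N.map h (f i x)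

theorem Iso.refl (M : QRep k I) : M.Iso M :=
  ⟨fun _ => LinearEquiv.refl k _, fun _ _ _ _ => rfl⟩

theorem Iso.symm {M N : QRep k I} : M.Iso N → N.Iso M := by
  rintro ⟨f, hf⟩
  refine ⟨fun i => (f i).symm, fun i j h x => ?_⟩
  rw [LinearEquiv.symm_apply_eq, hf, LinearEquiv.apply_symm_apply]

theorem Iso.trans {L M N : QRep k I} : L.Iso M → M.Iso N → L.Iso N := by
  rintro ⟨f, hf⟩ ⟨g, hg⟩
  exact ⟨fun i => (f i).trans (g i), fun i j h x => by simp [hf, hg]⟩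

/-- The dimension vector. -/
def dimVec (M : QRep k I) (i : I) : ℕ := Module.finrank k (M.V i)

theorem Iso.dimVec_eq {M N : QRep k I} : M.Iso N → M.dimVec = N.dimVec := by
  rintro ⟨f, -⟩
  funext i
  exact (f i).finrank_eq

/-- Subrepresentations (that is, `kQ`-submodules). -/
structure Sub (M : QRep k I) where
  carrier : ∀ i, Submodule k (M.V i)
  map_mem : ∀ (i j : I) (h : i ⟶ j) (x : M.V i), x ∈ carrier i → M.map h x ∈ carrier j

/-- A subrepresentation as a representation. -/
def Sub.toRep {M : QRep k I} (W : M.Sub) : QRep k I where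
  V i := W.carrier i
  map {i j} h := (M.map h).restrict (W.map_mem i j h)

/-- The quotient by a subrepresentation. -/
def Sub.quot {M : QRep k I} (W : M.Sub) : QRep k I where
  V i := M.V i ⧸ W.carrier i
  map {i j} h := (W.carrier i).mapQ (W.carrier j) (M.map h) (W.map_mem i j h)

theorem Sub.dimVec_add {M : QRep k I} (W : M.Sub) :
    M.dimVec = W.quot.dimVec + W.toRep.dimVec := by
  funext i
  exact ((W.carrier i).finrank_quotient_add_finrank).symm

/-- The direct sum of a finite family of representations. -/
def directSum {ι : Type} [Fintype ι] (E : ι → QRep k I) : QRep k I where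
  V i := ∀ a, (E a).V i
  map h := LinearMap.pi fun a => ((E a).map h).comp (LinearMap.proj a)

/-- Representations modulo isomorphism. -/
instance isoSetoid (k : Type u) [Field k] (I : Type v) [Quiver.{w + 1} I] : Setoid (QRep k I) where
  r := Iso
  iseqv := ⟨Iso.refl, Iso.symm, Iso.trans⟩

end QRep

/-- The set of isomorphism classes `[M]` of finite-dimensional representations. -/
def IsoClass (k : Type u) [Field k] (I : Type v) [Quiver.{w + 1} I] :=
  Quotient (QRep.isoSetoid k I)

/-- The isomorphism class `[M]`. -/
def QRep.cls {k : Type u} [Field k] {I : Type v} [Quiver.{w + 1} I] (M : QRep k I) :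
    IsoClass k I := Quotient.mk _ M

namespace IsoClass

variable {k : Type u} [Field k] {I : Type v} [Quiver.{w + 1} I]

/-- The dimension vector of an isomorphism class. -/
def dimVec (c : IsoClass k I) : I → ℕ :=
  Quotient.lift QRep.dimVec (fun _ _ h => QRep.Iso.dimVec_eq h) c

/-- Over a finite field there are finitely many isomorphism classes of a given dimension vector. -/
theorem finite_dimVec [Finite k] [Finite I] [∀ i j : I, Finite (i ⟶ j)] (d : I → ℕ) :
    {c : IsoClass k I | c.dimVec = d}.Finite := by
  let F : (∀ p : (Σ i : I, Σ j : I, (i ⟶ j)),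
      (Fin (d p.1) → k) →ₗ[k] (Fin (d p.2.1) → k)) → IsoClass k I := fun A =>
    QRep.cls { V := fun i => Fin (d i) → k, map := fun {i j} h => A ⟨i, j, h⟩ }
  have : ∀ a b : ℕ, Finite ((Fin a → k) →ₗ[k] (Fin b → k)) := fun a b =>
    Finite.of_injective (fun f => (f : (Fin a → k) → (Fin b → k))) DFunLike.coe_injective
  refine (Set.finite_range F).subset ?_
  intro c hc
  induction c using Quotient.inductionOn with
  | h M =>
    have hd : ∀ i, Module.finrank k (M.V i) = d i := fun i => congrFun hc i
    let e : ∀ i, M.V i ≃ₗ[k] (Fin (d i) → k) := fun i =>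
      LinearEquiv.ofFinrankEq _ _ (by rw [hd i]; simp)
    refine ⟨fun p => (e p.2.1).toLinearMap ∘ₗ M.map p.2.2 ∘ₗ (e p.1).symm.toLinearMap, ?_⟩
    refine Quotient.sound ⟨fun i => (e i).symm, fun i j h x => ?_⟩
    simp

end IsoClass

/-! ### Regular and homogeneous regular representations -/

namespace QRep

variable {k : Type u} [Field k] {I : Type v} [Fintype I] [Quiver.{w + 1} I]
  [∀ i j : I, Fintype (i ⟶ j)]

/-- The defect `⟨δ, dim M⟩` of `M`. For indecomposable `M` it is negative, positive or zero
according as `M` is preprojective, preinjective or regular. -/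
def defect (δ : I → ℕ) (M : QRep k I) : ℤ := eulerFormNat I δ M.dimVec

/-- Regular representations: defect zero, and no subrepresentation has positive defect
(so there are neither preprojective nor preinjective direct summands). -/
def IsRegular (δ : I → ℕ) (M : QRep k I) : Prop :=
  M.defect δ = 0 ∧ ∀ W : M.Sub, W.toRep.defect δ ≤ 0

/-- Regular simple representations: the simple objects of the category of regular ones. -/
def IsRegularSimple (δ : I → ℕ) (M : QRep k I) : Prop :=
  M.IsRegular δ ∧ M.dimVec ≠ 0 ∧
    ∀ W : M.Sub, W.toRep.IsRegular δ → (∀ i, W.carrier i = ⊥) ∨ (∀ i, W.carrier i = ⊤)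

/-- The regular simple representation `M((1), z)` at the mouth of a homogeneous tube `z` of degree
`d`: it is regular simple of dimension vector `d δ` (the regular simples of a non-homogeneous tube
have dimension vectors that are not multiples of `δ`). Every homogeneous tube has exactly one
regular simple up to isomorphism, so homogeneous tubes are distinct if and only if their
regular simples are not isomorphic. -/
def IsHomogeneousRegularSimple (δ : I → ℕ) (d : ℕ) (M : QRep k I) : Prop :=
  M.IsRegularSimple δ ∧ M.dimVec = d • δ

/-- The category `R_h` of homogeneous regular representations, that is, of the direct sums of
objects of homogeneous tubes: the representations with a finite filtration whose factors are
regular simples of homogeneous tubes. -/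
inductive IsHomogeneousRegular (δ : I → ℕ) : QRep k I → Prop
  | zero (M : QRep k I) (hM : M.dimVec = 0) : IsHomogeneousRegular δ M
  | ext (M : QRep k I) (W : M.Sub) (d : ℕ) (hW : IsHomogeneousRegular δ W.toRep)
      (hQ : W.quot.IsHomogeneousRegularSimple δ d) : IsHomogeneousRegular δ M

end QRep

/-! ### The Ringel-Hall algebra -/

section HallNumber

variable {k : Type u} [Field k] {I : Type v} [Quiver.{w + 1} I]

/-- The Hall number `g^L_{MN}`: the number of subrepresentations `W` of `L` with `W ≅ N` and
`L / W ≅ M`. -/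
def hallNumber (l m n : IsoClass k I) : ℕ :=
  Nat.card {W : l.out.Sub // W.toRep.cls = n ∧ W.quot.cls = m}

theorem dimVec_of_hallNumber_ne_zero {l m n : IsoClass k I} (h : hallNumber l m n ≠ 0) :
    l.dimVec = m.dimVec + n.dimVec := by
  obtain ⟨⟨W, rfl, rfl⟩⟩ := (Nat.card_ne_zero.mp h).1
  conv_lhs => rw [← Quotient.out_eq l]
  exact W.dimVec_add

end HallNumber

section Hall

variable (k : Type u) [Field k] [Fintype k] (I : Type v) [Fintype I] [Quiver.{w + 1} I]
  [∀ i j : I, Fintype (i ⟶ j)]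

/-- The field `ℚ(v_q)` inside `ℂ`, where `v_q = √q` and `q = |k|`. -/
abbrev HallField : IntermediateField ℚ ℂ :=
  IntermediateField.adjoin ℚ {((Real.sqrt (Fintype.card k) : ℝ) : ℂ)}

/-- The element `v_q = √q`. -/
def vq : HallField k :=
  ⟨((Real.sqrt (Fintype.card k) : ℝ) : ℂ), IntermediateField.mem_adjoin_simple_self ℚ _⟩

/-- The underlying space of the Ringel-Hall algebra: the `ℚ(v_q)`-space with basis `u_[M]`,
`[M]` running over the isomorphism classes. The basis element `u_[M]` is
`Finsupp.single [M] 1`, and the coefficient of `u_[M]` in `x` is `x [M]`. -/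
abbrev HallAlg : Type _ := IsoClass k I →₀ HallField k

variable {k I}

/-- The product of basis elements
`u_[M] * u_[N] = v^⟨dim M, dim N⟩ ∑_[L] g^L_{MN} u_[L]`, a finite sum. -/
def hallMulBasis (m n : IsoClass k I) : HallAlg k I :=
  Finsupp.ofSupportFinite
    (fun l => vq k ^ eulerFormNat I m.dimVec n.dimVec * (hallNumber l m n : HallField k))
    ((IsoClass.finite_dimVec (m.dimVec + n.dimVec)).subset fun l hl =>
      dimVec_of_hallNumber_ne_zero fun h0 => hl (by simp [h0]))

/-- The (twisted) multiplication of the Ringel-Hall algebra, extended bilinearly. -/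
def hallMul (x y : HallAlg k I) : HallAlg k I :=
  x.sum fun m a => y.sum fun n b => (a * b) • hallMulBasis m n

/-- The unit `1 = u_[0]`. -/
def hallOne : HallAlg k I :=
  Finsupp.single (QRep.cls { V := fun _ => PUnit, map := fun _ => 0 }) 1

/-- The product `x_1 * x_2 * ... * x_s` in the (associative, unital) Ringel-Hall algebra. -/
def hallProd (L : List (HallAlg k I)) : HallAlg k I :=
  L.foldr hallMul hallOne

variable (k) in
open Classical in
/-- `H_m = ∑ v_q^{-dim M} u_[M]`, summed over the classes `[M]` of homogeneous regular `M` with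
dimension vector `m δ`. -/
def hallH (δ : I → ℕ) (m : ℕ) : HallAlg k I :=
  Finsupp.ofSupportFinite
    (fun c => if c.dimVec = m • δ ∧ ∃ M : QRep k I, M.cls = c ∧ M.IsHomogeneousRegular δ
      then vq k ^ (-((∑ i, c.dimVec i : ℕ) : ℤ)) else 0)
    ((IsoClass.finite_dimVec (m • δ)).subset fun c hc => by
      by_contra h
      exact hc (if_neg fun h' => h h'.1))

variable (k) in
/-- `H_m` for an integer `m`, with `H_m = 0` for `m < 0`. -/
def hallHInt (δ : I → ℕ) (m : ℤ) : HallAlg k I :=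
  if 0 ≤ m then hallH k δ m.toNat else 0

variable (k) in
/-- `H_λ = H_{λ_1} * H_{λ_2} * ... * H_{λ_s}`. -/
def hallHPart (δ : I → ℕ) {s : ℕ} (lam : Fin s → ℕ) : HallAlg k I :=
  hallProd (List.ofFn fun a => hallH k δ (lam a))

variable (k) in
/-- `S_λ = det (H_{λ_a - a + b})_{1 ≤ a, b ≤ s}`, by the Leibniz formula. (The entries commute in
the Ringel-Hall algebra, so the order of the factors, here row by row, is immaterial.) -/
def hallSPart (δ : I → ℕ) {s : ℕ} (lam : Fin s → ℕ) : HallAlg k I :=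
  ∑ σ : Equiv.Perm (Fin s), Equiv.Perm.sign σ •
    hallProd (List.ofFn fun a : Fin s =>
      hallHInt k δ ((lam a : ℤ) - ((a : ℕ) : ℤ) + ((σ a : ℕ) : ℤ)))

end Hall

/-! ### Permutation modules and Specht modules of symmetric groups -/

section Symmetric

variable (n : ℕ) {s : ℕ} (lam : Fin s → ℕ)

/-- A `λ`-tabloid: an ordered set partition `{1, ..., n} = W_1 ⊔ ... ⊔ W_s` with `|W_a| = λ_a`,
recorded as the map sending a number to the index of the row containing it. -/
def Tabloid : Type := {f : Fin n → Fin s // ∀ a, Nat.card {x // f x = a} = lam a}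

/-- The natural action of the symmetric group on `λ`-tabloids. -/
instance : MulAction (Equiv.Perm (Fin n)) (Tabloid n lam) where
  smul g f := ⟨fun x => f.1 (g⁻¹ x), fun a => by
    rw [← f.2 a]
    exact Nat.card_congr ((g⁻¹ : Equiv.Perm (Fin n)).subtypeEquiv fun x => Iff.rfl)⟩
  one_smul f := rfl
  mul_smul g h f := rfl

/-- The permutation module `M^λ` over `ℂ`, with basis the `λ`-tabloids. -/
abbrev permModule : Representation ℂ (Equiv.Perm (Fin n)) (MonoidAlgebra ℂ (Tabloid n lam)) :=
  Representation.ofMulAction ℂ (Equiv.Perm (Fin n)) (Tabloid n lam)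

/-- A Young tableau of shape `λ`: a bijective filling of the cells `(a, b)`, with `a` the row and
`b < λ_a` the column, by the numbers `1, ..., n`. -/
abbrev Tableau : Type := (Σ a : Fin s, Fin (lam a)) ≃ Fin n

variable {n lam}

/-- The tabloid `{t}` of a tableau `t`. -/
def Tableau.tabloid (t : Tableau n lam) : Tabloid n lam :=
  ⟨fun x => (t.symm x).1, fun a => by
    have e : {x // (t.symm x).1 = a} ≃ {c : Σ a : Fin s, Fin (lam a) // c.1 = a} :=
      t.symm.subtypeEquiv fun x => Iff.rfl
    rw [Nat.card_congr (e.trans (Equiv.sigmaSubtype a))]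
    simp⟩

/-- A permutation lies in the column stabilizer `C_t` of the tableau `t`. -/
def Tableau.InColStab (t : Tableau n lam) (π : Equiv.Perm (Fin n)) : Prop :=
  ∀ x, ((t.symm (π x)).2 : ℕ) = ((t.symm x).2 : ℕ)

open Classical in
/-- The polytabloid `e_t = ∑_{π ∈ C_t} sgn(π) π{t}`. -/
def Tableau.polytabloid (t : Tableau n lam) : MonoidAlgebra ℂ (Tabloid n lam) :=
  ∑ π : Equiv.Perm (Fin n),
    if t.InColStab π then
      MonoidAlgebra.single (π • t.tabloid) (((Equiv.Perm.sign π : ℤˣ) : ℤ) : ℂ)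
    else 0

/-- The tableau `g t`, obtained from `t` by applying `g` to all entries. -/
def Tableau.perm (t : Tableau n lam) (g : Equiv.Perm (Fin n)) : Tableau n lam := t.trans g

theorem Tableau.apply_polytabloid (t : Tableau n lam) (g : Equiv.Perm (Fin n)) :
    permModule n lam g t.polytabloid = (t.perm g).polytabloid := by
  classical
  unfold Tableau.polytabloid
  rw [map_sum]
  refine Fintype.sum_equiv (MulAut.conj g).toEquiv _ _ fun π => ?_
  have hinv : ∀ x, (t.perm g).symm x = t.symm (g⁻¹ x) := fun x => rfl
  have hstab : (t.perm g).InColStab (MulAut.conj g π) ↔ t.InColStab π := by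
    have e1 : ∀ x, g⁻¹ (MulAut.conj g π x) = π (g⁻¹ x) := fun x => by
      simp [MulAut.conj_apply, Equiv.Perm.mul_apply]
    constructor
    · intro h x
      have h1 := h (g x)
      have e2 : g⁻¹ (g x) = x := by simp
      rw [hinv, hinv, e1, e2] at h1
      exact h1
    · intro h x
      rw [hinv, hinv, e1]
      exact h (g⁻¹ x)
  have htab : (MulAut.conj g π) • (t.perm g).tabloid = (g * π) • t.tabloid := by
    apply Subtype.ext
    funext x
    change ((t.perm g).symm ((g * π * g⁻¹)⁻¹ x)).1 = (t.symm ((g * π)⁻¹ x)).1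
    rw [hinv]
    congr 2
    simp [mul_inv_rev, Equiv.Perm.mul_apply]
  have hsign : Equiv.Perm.sign (MulAut.conj g π) = Equiv.Perm.sign π := by
    rw [MulAut.conj_apply, map_mul, map_mul, mul_comm, ← mul_assoc, ← map_mul]
    simp
  simp only [MulEquiv.toEquiv_eq_coe, MulEquiv.coe_toEquiv, hstab, htab, hsign]
  split_ifs
  · rw [Representation.ofMulAction_single, mul_smul]
  · simp

variable (n lam) in
/-- The Specht module `S^λ`: the subrepresentation of `M^λ` spanned by the polytabloids. -/
def spechtModule : Subrepresentation (permModule n lam) where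
  toSubmodule := Submodule.span ℂ (Set.range (Tableau.polytabloid (n := n) (lam := lam)))
  apply_mem_toSubmodule g x hx := by
    induction hx using Submodule.span_induction with
    | mem y hy =>
      obtain ⟨t, rfl⟩ := hy
      rw [Tableau.apply_polytabloid]
      exact Submodule.subset_span ⟨_, rfl⟩
    | zero => simp
    | add y z _ _ hy hz => rw [map_add]; exact Submodule.add_mem _ hy hz
    | smul a y _ hy => rw [map_smul]; exact Submodule.smul_mem _ a hy

end Symmetric

end AffineHall

end

/-!
The proof has three parts, which meet in the permutation characters `permChar α` of the symmetric
group, where `α` is a vector of integers: `permChar α g` is the number of maps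
`{1, ..., n} → {1, ..., s}` that are constant on the cycles of `g` and take the value `a` exactly
`α_a` times.

*Hall algebra.* The coefficient of `u_[M]` in a product is a sum over flags of subrepresentations
of `M`. The factors `H_m` are supported on regular representations whose dimension vector is a
multiple of `δ`; since `⟨δ, δ⟩ = 0`, the twist by powers of `v_q` disappears. The defect is at most
zero on all subrepresentations of a regular representation and satisfies the modular identity, so
the subrepresentations of defect zero form a lattice, whose atoms are the regular simple ones. If
`M = ⨁ E_j` with pairwise nonisomorphic regular simple `E_j`, this lattice consists of the partial
direct sums (`exists_eq_coordSub`). Hence the coefficient of `u_[M]` in `H_{α_1} * ⋯ * H_{α_s}` is,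
up to the power of `v_q`, the number of maps `{1, ..., l} → {1, ..., s}` such that the `μ_j` over
`a` add up to `α_a` (`hallProd_directSum`). As `μ` is the cycle type of `g`, this number is
`permChar α g` (`permChar_eq_assignCount`). This gives the formula for `H_λ`, and for `S_λ` it
gives the value at `g` of the virtual character
`detChar λ = ∑_σ sgn(σ) permChar (λ - id + σ)`.

*Norm of the virtual character.* By Burnside's lemma, the scalar product of `permChar α` and
`permChar β` is the number of matrices of natural numbers with row sums `α` and column sums `β`,
which is a coefficient of `∏ 1 / (1 - x_i y_j)`. The Cauchy determinant
`det (1 / (1 - x_i y_j)) = Δ(x) Δ(y) ∏ 1 / (1 - x_i y_j)` then shows that `detChar λ` has norm one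
(`sum_detChar_sq`).

*The Specht module.* Let `e` be a polytabloid of shape `λ`. Every `λ`-tabloid is either in the
orbit of the given one under the column stabilizer or fixed by a transposition of two entries of
the same column, so `e` spans the alternating vectors of the permutation module. This implies that
`m ↦ ∑_h ⟨h e, m⟩ h e` acts as a positive scalar `c` on the Specht module, and therefore `c χ(g) =
∑_h ⟨e, h⁻¹ g h e⟩` for its character `χ`. From this formula `χ` has norm one and scalar product
one with `permChar λ`. For `σ ≠ 1` the weight `λ - id + σ` has a larger sum of squares than `λ`,
so that every map of this weight is fixed by a transposition of two entries of the same column,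
and `χ` is orthogonal to `permChar (λ - id + σ)`. Thus `χ` and `detChar λ` are two functions of
norm one with scalar product one, and they are equal (`spechtModule_character`).
-/

noncomputable section

namespace AffineHall

/-! ### Matrix coefficients of alternating vectors -/

section Alternating

variable {G T X : Type*} [Group G] [MulAction G T] [MulAction G X]
  {C : Subgroup G} {ε : G →* ℤˣ} {t₀ : T} {e : T → ℤ}

open Classical in
theorem card_fixedBy_eq_sum [Fintype X] (g : G) :
    (Nat.card (MulAction.fixedBy X g) : ℤ) = ∑ v : X, if g⁻¹ • v = v then 1 else 0 := by
  rw [Finset.sum_boole, Nat.card_eq_fintype_card, Fintype.card_subtype]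
  congr 2
  ext v
  simp only [MulAction.mem_fixedBy, Finset.mem_filter, Finset.mem_univ, true_and]
  rw [inv_smul_eq_iff, eq_comm]

/-- A function on a `G`-set that transforms by the sign character `ε` under the subgroup `C`. -/
def IsAlternating (C : Subgroup G) (ε : G →* ℤˣ) (y : X → ℤ) : Prop :=
  ∀ c ∈ C, ∀ u, y (c • u) = (ε c : ℤ) * y u

theorem IsAlternating.eq_zero {y : X → ℤ} (hy : IsAlternating C ε y) {u : X}
    (hu : ∃ c ∈ C, ε c = -1 ∧ c • u = u) : y u = 0 := by
  obtain ⟨c, hc, h1, h2⟩ := hu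
  have := hy c hc u
  rw [h2, h1] at this
  simp only [Units.val_neg, Units.val_one, neg_mul, one_mul] at this
  lia

/-- An alternating function `e` on `T`, normalised by `e t₀ = 1`, in a situation where every point
of `T` either lies in the `C`-orbit of `t₀` or is fixed by an element of `C` of sign `-1`. The
alternating functions on `T` are then the multiples of `e`; the example in view is a polytabloid. -/
structure IsAltGenerator (C : Subgroup G) (ε : G →* ℤˣ) (t₀ : T) (e : T → ℤ) : Prop where
  alt : IsAlternating C ε e
  base : e t₀ = 1
  cover : ∀ u : T, (∃ c ∈ C, ε c = -1 ∧ c • u = u) ∨ ∃ c ∈ C, u = c • t₀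

theorem IsAltGenerator.eq_mul (h : IsAltGenerator C ε t₀ e) {y : T → ℤ}
    (hy : IsAlternating C ε y) (u : T) : y u = y t₀ * e u := by
  rcases h.cover u with hu | ⟨c, hc, rfl⟩
  · rw [hy.eq_zero hu, h.alt.eq_zero hu, mul_zero]
  · rw [hy c hc, h.alt c hc, h.base, mul_one, mul_comm]

variable [Fintype T]

/-- The matrix coefficient `⟨e, g e⟩`. -/
def matCoeff (e : T → ℤ) (g : G) : ℤ := ∑ u, e u * e (g⁻¹ • u)

theorem matCoeff_mul (h : IsAlternating C ε e) {c : G} (hc : c ∈ C) (g : G) :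
    matCoeff e (c * g) = (ε c : ℤ) * matCoeff e g := by
  unfold matCoeff
  rw [Finset.mul_sum, ← Equiv.sum_comp (MulAction.toPerm c)]
  refine Finset.sum_congr rfl fun u _ => ?_
  rw [MulAction.toPerm_apply, h c hc, mul_inv_rev, mul_smul, inv_smul_smul, mul_assoc]

theorem matCoeff_inv (g : G) : matCoeff e g⁻¹ = matCoeff e g := by
  unfold matCoeff
  rw [← Equiv.sum_comp (MulAction.toPerm g⁻¹)]
  refine Finset.sum_congr rfl fun u _ => ?_
  rw [MulAction.toPerm_apply, inv_inv, smul_inv_smul, mul_comm]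

variable [Fintype G]

/-- The function `∑_g ⟨e, g e⟩ g m` is alternating, for every function `m`. -/
theorem isAlternating_sum_matCoeff (h : IsAlternating C ε e) (m : X → ℤ) :
    IsAlternating C ε fun u => ∑ g : G, matCoeff e g * m (g⁻¹ • u) := by
  intro c hc u
  simp only
  rw [Finset.mul_sum, ← Equiv.sum_comp (Equiv.mulLeft c)]
  refine Finset.sum_congr rfl fun g _ => ?_
  rw [Equiv.coe_mulLeft, matCoeff_mul h hc, mul_inv_rev, mul_smul, inv_smul_smul, mul_assoc]

/-- The scalar by which `m ↦ ∑_g ⟨m, g e⟩ g e` acts on `e`. -/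
def altScalar (G : Type*) [Group G] [Fintype G] [MulAction G T] (t₀ : T) (e : T → ℤ) : ℤ :=
  ∑ g : G, matCoeff e g * e (g⁻¹ • t₀)

theorem IsAltGenerator.sum_matCoeff_mul (h : IsAltGenerator C ε t₀ e) (u : T) :
    ∑ g : G, matCoeff e g * e (g⁻¹ • u) = altScalar G t₀ e * e u :=
  h.eq_mul (isAlternating_sum_matCoeff h.alt e) u

theorem IsAltGenerator.altScalar_pos (h : IsAltGenerator C ε t₀ e) : 0 < altScalar G t₀ e := by
  have h1 : 0 < matCoeff e (1 : G) := by
    unfold matCoeff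
    refine Finset.sum_pos' (fun u _ => ?_) ⟨t₀, Finset.mem_univ _, ?_⟩
    · simpa using mul_self_nonneg (e u)
    · simp [h.base]
  have h2 : ∑ g : G, matCoeff e g * matCoeff e g = altScalar G t₀ e * matCoeff e (1 : G) := by
    calc ∑ g : G, matCoeff e g * matCoeff e g
        = ∑ u, e u * ∑ g : G, matCoeff e g * e (g⁻¹ • u) := by
          simp_rw [Finset.mul_sum]
          rw [Finset.sum_comm]
          refine Finset.sum_congr rfl fun g _ => ?_
          conv_lhs => arg 2; rw [matCoeff]
          rw [Finset.mul_sum]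
          refine Finset.sum_congr rfl fun u _ => ?_
          ring
      _ = _ := by
          simp_rw [h.sum_matCoeff_mul]
          unfold matCoeff
          rw [Finset.mul_sum]
          refine Finset.sum_congr rfl fun u _ => ?_
          rw [inv_one, one_smul]; ring
  have h3 : 0 < ∑ g : G, matCoeff e g * matCoeff e g :=
    Finset.sum_pos' (fun g _ => mul_self_nonneg _) ⟨1, Finset.mem_univ _, mul_pos h1 h1⟩
  rw [h2] at h3
  exact pos_of_mul_pos_left h3 h1.le

open Classical in
/-- The trace of `∑_g ⟨e, g e⟩ g` on the permutation module of `T`. -/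
theorem IsAltGenerator.sum_matCoeff_mul_fixed (h : IsAltGenerator C ε t₀ e) :
    ∑ g : G, matCoeff e g * (Nat.card (MulAction.fixedBy T g) : ℤ) = altScalar G t₀ e := by
  have key : ∀ v : T, ∑ g : G, matCoeff e g * (if g⁻¹ • v = v then 1 else 0)
      = ∑ g : G, matCoeff e g * (if g⁻¹ • t₀ = v then 1 else 0) * e v := by
    intro v
    have := h.eq_mul (isAlternating_sum_matCoeff h.alt fun u => if u = v then (1 : ℤ) else 0) v
    rw [this, Finset.sum_mul]
  simp_rw [card_fixedBy_eq_sum, Finset.mul_sum]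
  rw [Finset.sum_comm]
  simp_rw [key]
  rw [Finset.sum_comm]
  refine Finset.sum_congr rfl fun g _ => ?_
  simp

open Classical in
theorem sum_matCoeff_mul_fixed_eq_zero [Fintype X] (h : IsAlternating C ε e)
    (hX : ∀ v : X, ∃ c ∈ C, ε c = -1 ∧ c • v = v) :
    ∑ g : G, matCoeff e g * (Nat.card (MulAction.fixedBy X g) : ℤ) = 0 := by
  have hfix : ∀ g : G, (Nat.card (MulAction.fixedBy X g) : ℤ)
      = ∑ v : X, if g⁻¹ • v = v then 1 else 0 := by
    intro g
    rw [Finset.sum_boole, Nat.card_eq_fintype_card, Fintype.card_subtype]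
    congr 2
    ext v
    simp only [MulAction.mem_fixedBy, Finset.mem_filter, Finset.mem_univ, true_and]
    rw [inv_smul_eq_iff, eq_comm]
  simp_rw [card_fixedBy_eq_sum, Finset.mul_sum]
  rw [Finset.sum_comm]
  refine Finset.sum_eq_zero fun v _ => ?_
  exact (isAlternating_sum_matCoeff h fun u => if u = v then (1 : ℤ) else 0).eq_zero (hX v)

/-- The class function `∑_h ⟨e, h⁻¹ g h e⟩`. -/
def avgCoeff (e : T → ℤ) (g : G) : ℤ := ∑ h : G, matCoeff e (h⁻¹ * g * h)

theorem sum_avgCoeff_mul (φ : G → ℤ) (hφ : ∀ g h : G, φ (h⁻¹ * g * h) = φ g) :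
    ∑ g : G, avgCoeff e g * φ g = Fintype.card G * ∑ g : G, matCoeff e g * φ g := by
  unfold avgCoeff
  simp_rw [Finset.sum_mul]
  rw [Finset.sum_comm, ← nsmul_eq_mul, ← Finset.card_univ, ← Finset.sum_const]
  refine Finset.sum_congr rfl fun h _ => ?_
  rw [← Equiv.sum_comp (MulAut.conj h).toEquiv]
  refine Finset.sum_congr rfl fun g _ => ?_
  simp only [MulEquiv.toEquiv_eq_coe, MulEquiv.coe_toEquiv, MulAut.conj_apply]
  rw [← hφ (h * g * h⁻¹) h]
  congr 2 <;> group

theorem avgCoeff_conj (g h : G) : avgCoeff e (h⁻¹ * g * h) = avgCoeff e g := by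
  unfold avgCoeff
  rw [← Equiv.sum_comp (Equiv.mulLeft h) fun x => matCoeff e (x⁻¹ * g * x)]
  refine Finset.sum_congr rfl fun x _ => ?_
  simp [mul_assoc]

theorem IsAltGenerator.sum_avgCoeff_sq (h : IsAltGenerator C ε t₀ e) :
    ∑ g : G, avgCoeff e g * avgCoeff e g = Fintype.card G * altScalar G t₀ e ^ 2 := by
  rw [sum_avgCoeff_mul _ fun g h => avgCoeff_conj g h]
  congr 1
  calc ∑ g : G, matCoeff e g * avgCoeff e g
      = ∑ x : G, ∑ u, e u * ∑ g : G, matCoeff e g * e (x⁻¹ • g⁻¹ • x • u) := by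
        simp_rw [avgCoeff, matCoeff, Finset.mul_sum]
        rw [Finset.sum_comm]
        refine Finset.sum_congr rfl fun x _ => ?_
        rw [Finset.sum_comm]
        refine Finset.sum_congr rfl fun u _ => Finset.sum_congr rfl fun g _ => ?_
        simp only [mul_inv_rev, inv_inv, mul_smul]
        ring
    _ = ∑ x : G, ∑ u, e u *
          ((∑ g : G, matCoeff e g * e (x⁻¹ • g⁻¹ • t₀)) * e (x • u)) := by
        refine Finset.sum_congr rfl fun x _ => Finset.sum_congr rfl fun u _ => ?_
        rw [← h.eq_mul (isAlternating_sum_matCoeff h.alt fun w => e (x⁻¹ • w)) (x • u)]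
    _ = ∑ x : G, (∑ g : G, matCoeff e g * e (x⁻¹ • g⁻¹ • t₀)) * matCoeff e x := by
        refine Finset.sum_congr rfl fun x _ => ?_
        rw [← matCoeff_inv x, matCoeff, Finset.mul_sum]
        refine Finset.sum_congr rfl fun u _ => ?_
        rw [inv_inv]; ring
    _ = ∑ g : G, matCoeff e g * ∑ x : G, matCoeff e x * e (x⁻¹ • g⁻¹ • t₀) := by
        simp_rw [Finset.sum_mul, Finset.mul_sum]
        rw [Finset.sum_comm]
        refine Finset.sum_congr rfl fun x _ => Finset.sum_congr rfl fun u _ => ?_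
        ring
    _ = altScalar G t₀ e ^ 2 := by
        simp_rw [h.sum_matCoeff_mul]
        rw [sq]
        conv_rhs => arg 2; rw [altScalar]
        rw [Finset.mul_sum]
        refine Finset.sum_congr rfl fun g _ => ?_
        ring

end Alternating

/-! ### The Cauchy determinant -/

section CauchyDet

open Polynomial in
/-- **Cauchy's determinant**, in the form `det (1 / (1 - x_i y_j)) ∏ (1 - x_i y_j) = Δ(x) Δ(y)`. -/
theorem cauchy_det {K : Type*} [Field K] {s : ℕ} (x y : Fin s → K) (hy0 : ∀ j, y j ≠ 0)
    (hy : Function.Injective y) (hxy : ∀ i j, 1 - x i * y j ≠ 0) :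
    (Matrix.of fun i j => (1 - x i * y j)⁻¹).det * ∏ i, ∏ j, (1 - x i * y j)
      = (Matrix.vandermonde x).det * (Matrix.vandermonde y).det := by
  classical
  -- After clearing denominators row by row, the entries are values of the polynomials `p j`.
  let p : Fin s → K[X] := fun j => ∏ k ∈ {j}ᶜ, (1 - C (y k) * X)
  have hp : ∀ j, (p j).natDegree < s := by
    intro j
    have h1 : (p j).natDegree ≤ ∑ k ∈ ({j}ᶜ : Finset (Fin s)), 1 := by
      refine (natDegree_prod_le _ _).trans (Finset.sum_le_sum fun k _ => ?_)
      refine (natDegree_sub_le _ _).trans ?_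
      simpa using natDegree_C_mul_le (y k) X |>.trans natDegree_X_le
    have h2 := j.2
    simp only [Finset.sum_const, Finset.card_compl, Fintype.card_fin, Finset.card_singleton,
      smul_eq_mul, mul_one] at h1
    omega
  let B : Matrix (Fin s) (Fin s) K := Matrix.of fun m j => (p j).coeff m
  have hfac : ∀ z : Fin s → K, (Matrix.of fun i j => (p j).eval (z i))
      = Matrix.vandermonde z * B := by
    intro z
    ext i j
    rw [Matrix.of_apply, eval_eq_sum_range' (hp j), Matrix.mul_apply,
      ← Fin.sum_univ_eq_sum_range (fun m => (p j).coeff m * z i ^ m)]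
    exact Finset.sum_congr rfl fun m _ => mul_comm _ _
  have heval : ∀ (z : K) j, (p j).eval z = ∏ k ∈ {j}ᶜ, (1 - y k * z) := by
    intro z j
    simp [p, eval_prod]
  have hB : B.det = (Matrix.vandermonde y).det := by
    have hne : (Matrix.vandermonde fun i => (y i)⁻¹).det ≠ 0 :=
      Matrix.det_vandermonde_ne_zero_iff.mpr fun i j h => hy (inv_injective h)
    have hdiag : (Matrix.of fun i j => (p j).eval (y i)⁻¹)
        = Matrix.diagonal fun j => ∏ k ∈ {j}ᶜ, (1 - y k * (y j)⁻¹) := by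
      ext i j
      rw [Matrix.of_apply, heval, Matrix.diagonal_apply]
      split_ifs with h
      · rw [h]
      · refine Finset.prod_eq_zero (i := i) (by simpa using h) ?_
        rw [mul_inv_cancel₀ (hy0 i), sub_self]
    have h1 := congrArg Matrix.det (hfac fun i => (y i)⁻¹)
    rw [hdiag, Matrix.det_diagonal, Matrix.det_mul] at h1
    refine mul_left_cancel₀ hne ?_
    rw [← h1, Matrix.det_vandermonde, Matrix.det_vandermonde,
      ← Finset.prod_prod_Ioi_mul_eq_prod_prod_off_diag fun k j => 1 - y k * (y j)⁻¹,
      ← Finset.prod_mul_distrib]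
    refine Finset.prod_congr rfl fun i _ => ?_
    rw [← Finset.prod_mul_distrib]
    refine Finset.prod_congr rfl fun j _ => ?_
    have := hy0 i
    have := hy0 j
    field_simp
  rw [← hB, ← Matrix.det_mul, ← hfac, mul_comm, ← Matrix.det_mul_column]
  congr 1
  ext i j
  rw [Matrix.of_apply, Matrix.of_apply, Matrix.of_apply, heval,
    Fintype.prod_eq_mul_prod_compl j, mul_comm, ← mul_assoc, inv_mul_cancel₀ (hxy i j), one_mul]
  exact Finset.prod_congr rfl fun k _ => by rw [mul_comm]

end CauchyDet

/-! ### Counting matrices with prescribed margins -/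

section Margins

open MvPowerSeries

/-- The geometric series `1 / (1 - X^m)`. -/
def geomSeries {σ : Type*} (m : σ →₀ ℕ) : MvPowerSeries σ ℤ := by
  classical exact fun d => if ∃ k : ℕ, d = k • m then 1 else 0

open Classical in
theorem coeff_geomSeries {σ : Type*} (m d : σ →₀ ℕ) :
    coeff d (geomSeries m) = if ∃ k : ℕ, d = k • m then 1 else 0 := rfl

theorem geomSeries_mul {σ : Type*} {m : σ →₀ ℕ} (hm : m ≠ 0) :
    (1 - monomial m (1 : ℤ)) * geomSeries m = 1 := by
  classical
  ext d
  rw [sub_mul, one_mul, map_sub, coeff_monomial_mul, coeff_one, coeff_geomSeries,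
    coeff_geomSeries, one_mul]
  by_cases hd : ∃ k : ℕ, d = k • m
  · obtain ⟨k, rfl⟩ := hd
    rw [if_pos ⟨k, rfl⟩]
    rcases k with _ | k
    · have : ¬ m ≤ 0 • m := by
        rw [zero_smul]
        exact fun h => hm (le_antisymm h zero_le)
      rw [if_neg this, if_pos (zero_smul ℕ m), sub_zero]
    · have h1 : m ≤ (k + 1) • m := by rw [succ_nsmul]; exact le_add_self
      have h2 : (k + 1) • m ≠ 0 := smul_ne_zero (Nat.succ_ne_zero k) hm
      rw [if_pos h1, if_neg h2, if_pos ⟨k, by rw [succ_nsmul, add_tsub_cancel_right]⟩, sub_self]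
  · have h0 : d ≠ 0 := fun h => hd ⟨0, by rw [h, zero_smul]⟩
    rw [if_neg hd, if_neg h0]
    split_ifs with h1 h2
    · obtain ⟨k, hk⟩ := h2
      exact absurd ⟨k + 1, by rw [succ_nsmul, ← hk, tsub_add_cancel_of_le h1]⟩ hd
    · rfl
    · rfl

theorem coeff_prod_geomSeries {σ ι : Type*} [Fintype ι] (m : ι → σ →₀ ℕ) (hm : ∀ i, m i ≠ 0)
    (d : σ →₀ ℕ) :
    coeff d (∏ i, geomSeries (m i)) = (Nat.card {A : ι → ℕ // ∑ i, A i • m i = d} : ℤ) := by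
  classical
  rw [coeff_prod]
  have h1 : ∀ l : ι →₀ σ →₀ ℕ, (∏ i, coeff (l i) (geomSeries (m i)))
      = if ∀ i, ∃ k : ℕ, l i = k • m i then 1 else 0 := by
    intro l
    simp_rw [coeff_geomSeries]
    split_ifs with h
    · exact Finset.prod_eq_one fun i _ => if_pos (h i)
    · push Not at h
      obtain ⟨i, hi⟩ := h
      exact Finset.prod_eq_zero (Finset.mem_univ i) (if_neg fun ⟨k, hk⟩ => hi k hk)
  simp_rw [h1]
  rw [Finset.sum_boole, ← Nat.card_eq_finsetCard]
  congr 1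
  symm
  refine Nat.card_eq_of_bijective (fun A : {A : ι → ℕ // ∑ i, A i • m i = d} =>
    (⟨Finsupp.equivFunOnFinite.symm fun i => A.1 i • m i, by
      simp only [Finset.mem_filter, Finset.mem_finsuppAntidiag, Finset.subset_univ, and_true]
      exact ⟨A.2, fun i => ⟨A.1 i, rfl⟩⟩⟩ : Finset.filter
        (fun l : ι →₀ σ →₀ ℕ => ∀ i, ∃ k : ℕ, l i = k • m i) (Finset.univ.finsuppAntidiag d)))
    ⟨?_, ?_⟩
  · intro A B h
    ext i
    have := DFunLike.congr_fun (Subtype.ext_iff.mp h) i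
    obtain ⟨j, hj⟩ := DFunLike.ne_iff.mp (hm i)
    have hj' := DFunLike.congr_fun this j
    exact Nat.eq_of_mul_eq_mul_right (Nat.pos_of_ne_zero hj) hj'
  · rintro ⟨l, hl⟩
    simp only [Finset.mem_filter, Finset.mem_finsuppAntidiag] at hl
    choose k hk using hl.2
    refine ⟨⟨k, ?_⟩, ?_⟩
    · rw [← hl.1.1]
      exact Finset.sum_congr rfl fun i _ => (hk i).symm
    · ext1
      ext1 i
      simp [hk]

variable {s : ℕ}

/-- The number of matrices of natural numbers with row sums `α` and column sums `β`. -/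
def marginCount (α β : Fin s → ℤ) : ℕ :=
  Nat.card {A : Fin s × Fin s → ℕ //
    (∀ i, ∑ j, (A (i, j) : ℤ) = α i) ∧ ∀ j, ∑ i, (A (i, j) : ℤ) = β j}

/-- The exponent of the monomial `x_i y_j`. -/
def pairExp (i j : Fin s) : Fin s ⊕ Fin s →₀ ℕ :=
  Finsupp.single (Sum.inl i) 1 + Finsupp.single (Sum.inr j) 1

theorem pairExp_ne_zero (i j : Fin s) : pairExp i j ≠ 0 := fun h => by
  have := DFunLike.congr_fun h (Sum.inl i)
  simp [pairExp] at this

theorem monomial_pairExp (i j : Fin s) :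
    monomial (pairExp i j) (1 : ℤ) = X (Sum.inl i) * X (Sum.inr j) := by
  rw [X, X, monomial_mul_monomial, one_mul]; rfl

theorem det_geomSeries :
    (Matrix.of fun i j : Fin s => geomSeries (pairExp i j)).det
      = (Matrix.vandermonde fun i : Fin s => (X (Sum.inl i) : MvPowerSeries (Fin s ⊕ Fin s) ℤ)).det
        * (Matrix.vandermonde fun j : Fin s => X (Sum.inr j)).det
        * ∏ p : Fin s × Fin s, geomSeries (pairExp p.1 p.2) := by
  have hg : ∀ i j : Fin s, (1 - X (Sum.inl i) * X (Sum.inr j)) * geomSeries (pairExp i j) = 1 := by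
    intro i j
    rw [← monomial_pairExp]
    exact geomSeries_mul (pairExp_ne_zero i j)
  have hX : Function.Injective fun a : Fin s ⊕ Fin s => (X a : MvPowerSeries _ ℤ) := fun a b h => by
    classical
    have := congrArg (coeff (Finsupp.single a 1)) h
    simp only [coeff_X, if_true] at this
    by_contra hab
    rw [if_neg] at this
    · exact one_ne_zero this
    · exact fun h' => hab (Finsupp.single_left_injective one_ne_zero h')
  have hX0 : ∀ a : Fin s ⊕ Fin s, (X a : MvPowerSeries _ ℤ) ≠ 0 := fun a h => by
    classical
    have := congrArg (coeff (Finsupp.single a 1)) h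
    simp [coeff_X] at this
  have key' : ∀ (K : Type) [Field K] (φ : MvPowerSeries (Fin s ⊕ Fin s) ℤ →+* K),
      Function.Injective φ →
      (Matrix.of fun i j : Fin s => geomSeries (pairExp i j)).det
          * ∏ i, ∏ j, (1 - X (Sum.inl i) * X (Sum.inr j))
        = (Matrix.vandermonde fun i : Fin s => X (Sum.inl i)).det
          * (Matrix.vandermonde fun j : Fin s => X (Sum.inr j)).det := by
    intro K _ φ hφ
    have hφg : ∀ i j : Fin s, (1 - φ (X (Sum.inl i)) * φ (X (Sum.inr j)))
        * φ (geomSeries (pairExp i j)) = 1 := by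
      intro i j
      rw [← map_one φ, ← map_mul, ← map_sub, ← map_mul, hg]
    have hinv : ∀ i j : Fin s, φ (geomSeries (pairExp i j))
        = (1 - φ (X (Sum.inl i)) * φ (X (Sum.inr j)))⁻¹ :=
      fun i j => eq_inv_of_mul_eq_one_right (hφg i j)
    apply hφ
    have := cauchy_det (fun i : Fin s => φ (X (Sum.inl i))) (fun j : Fin s => φ (X (Sum.inr j)))
      (fun j h => hX0 _ (hφ (h.trans (map_zero φ).symm)))
      (fun i j h => Sum.inr_injective (hX (hφ h))) fun i j => left_ne_zero_of_mul_eq_one (hφg i j)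
    have e1 : φ.mapMatrix (Matrix.of fun i j : Fin s => geomSeries (pairExp i j))
        = Matrix.of fun i j => (1 - φ (X (Sum.inl i)) * φ (X (Sum.inr j)))⁻¹ := by
      ext i j; exact hinv i j
    have e2 : ∀ f : Fin s → Fin s ⊕ Fin s, φ.mapMatrix (Matrix.vandermonde fun i : Fin s => X (f i))
        = Matrix.vandermonde fun i : Fin s => φ (X (f i)) := by
      intro f; ext i j; exact map_pow φ _ _
    rw [map_mul, map_mul, RingHom.map_det, RingHom.map_det, RingHom.map_det, e1, e2, e2, ← this]
    simp only [map_prod, map_sub, map_mul, map_one]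
  have key := key' (FractionRing (MvPowerSeries (Fin s ⊕ Fin s) ℤ)) (algebraMap _ _)
    (IsFractionRing.injective _ _)
  rw [← key, mul_assoc, Fintype.prod_prod_type, ← Finset.prod_mul_distrib]
  simp_rw [← Finset.prod_mul_distrib, hg]
  simp

open Classical in
theorem coeff_prod_pairExp (d : Fin s ⊕ Fin s →₀ ℕ) :
    coeff d (∏ p : Fin s × Fin s, geomSeries (pairExp p.1 p.2))
      = (marginCount (fun i => (d (Sum.inl i) : ℤ)) fun j => (d (Sum.inr j) : ℤ) : ℤ) := by
  rw [coeff_prod_geomSeries _ fun p => pairExp_ne_zero _ _, marginCount]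
  congr 1
  refine Nat.card_congr (Equiv.subtypeEquivRight fun A => ?_)
  rw [DFunLike.ext_iff, Sum.forall]
  refine and_congr (forall_congr' fun i => ?_) (forall_congr' fun j => ?_)
  · rw [Finsupp.finsetSum_apply, Fintype.sum_prod_type, ← Nat.cast_sum, Nat.cast_inj]
    simp [pairExp, Finsupp.single_apply]
  · rw [Finsupp.finsetSum_apply, Fintype.sum_prod_type, ← Nat.cast_sum, Nat.cast_inj]
    simp [pairExp, Finsupp.single_apply]

theorem marginCount_eq_zero {α β : Fin s → ℤ} (h : (∃ i, α i < 0) ∨ ∃ j, β j < 0) :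
    marginCount α β = 0 := by
  rw [marginCount, Nat.card_eq_zero]
  refine Or.inl ⟨fun ⟨A, hA, hA'⟩ => ?_⟩
  rcases h with ⟨i, hi⟩ | ⟨j, hj⟩
  · rw [← hA i] at hi
    exact absurd hi (not_lt.mpr (Finset.sum_nonneg fun _ _ => Int.natCast_nonneg _))
  · rw [← hA' j] at hj
    exact absurd hj (not_lt.mpr (Finset.sum_nonneg fun _ _ => Int.natCast_nonneg _))

/-- The coefficient of `x^a y^a` in `det (1 / (1 - x_i y_j)) = Δ(x) Δ(y) ∏ 1 / (1 - x_i y_j)`,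
for distinct exponents `a_i`: on the left only the diagonal term of the determinant contributes. -/
theorem sum_sign_mul_marginCount (a : Fin s → ℕ) (ha : Function.Injective a) :
    ∑ σ : Equiv.Perm (Fin s), ∑ τ : Equiv.Perm (Fin s),
      ((Equiv.Perm.sign σ : ℤ) * (Equiv.Perm.sign τ : ℤ)) *
        (marginCount (fun i => (a i : ℤ) - (σ i : ℕ)) fun j => (a j : ℤ) - (τ j : ℕ) : ℤ) = 1 := by
  classical
  let d : Fin s ⊕ Fin s →₀ ℕ := Finsupp.equivFunOnFinite.symm (Sum.elim a a)
  have hdl : ∀ i, d (Sum.inl i) = a i := fun i => rfl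
  have hdr : ∀ i, d (Sum.inr i) = a i := fun i => rfl
  have hsol : ∀ (π : Equiv.Perm (Fin s)) (A : Fin s → ℕ),
      ∑ i, A i • pairExp (π i) i = d ↔ (∀ i, A i = a (π i)) ∧ ∀ i, A i = a i := by
    intro π A
    rw [DFunLike.ext_iff, Sum.forall]
    refine and_congr ?_ (forall_congr' fun j => ?_)
    · rw [← π.forall_congr_right]
      refine forall_congr' fun i => ?_
      rw [hdl, Finsupp.finsetSum_apply, Finset.sum_eq_single i]
      · simp [pairExp]
      · intro b _ hb
        simp [pairExp, hb]
      · simp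
    · rw [hdr, Finsupp.finsetSum_apply, Finset.sum_eq_single j]
      · simp [pairExp]
      · intro b _ hb
        simp [pairExp, hb]
      · simp
  have hleft : coeff d (Matrix.of fun i j : Fin s => geomSeries (pairExp i j)).det = 1 := by
    have hterm : ∀ π : Equiv.Perm (Fin s), coeff d
        (((Equiv.Perm.sign π : ℤ) : MvPowerSeries (Fin s ⊕ Fin s) ℤ)
          * ∏ i, geomSeries (pairExp (π i) i))
        = (Equiv.Perm.sign π : ℤ) *
          (Nat.card {A : Fin s → ℕ // (∀ i, A i = a (π i)) ∧ ∀ i, A i = a i} : ℤ) := by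
      intro π
      rw [← zsmul_eq_mul, map_zsmul, coeff_prod_geomSeries _ fun i => pairExp_ne_zero _ _,
        zsmul_eq_mul, Int.cast_id]
      congr 2
      exact Nat.card_congr (Equiv.subtypeEquivRight fun A => hsol π A)
    rw [Matrix.det_apply', map_sum]
    simp only [Matrix.of_apply]
    simp_rw [hterm]
    rw [Finset.sum_eq_single 1]
    · rw [Equiv.Perm.sign_one, Units.val_one, one_mul, Nat.cast_eq_one,
        Nat.card_eq_one_iff_unique]
      exact ⟨⟨fun A B => Subtype.ext (funext fun i => (A.2.2 i).trans (B.2.2 i).symm)⟩,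
        ⟨⟨a, fun _ => rfl, fun _ => rfl⟩⟩⟩
    · intro π _ hπ
      rw [Nat.cast_eq_zero.mpr, mul_zero]
      rw [Nat.card_eq_zero]
      refine Or.inl ⟨fun ⟨A, h1, h2⟩ => hπ ?_⟩
      ext i
      rw [← ha ((h2 i).symm.trans (h1 i))]
      rfl
    · simp
  have hvdm : ∀ f : Fin s → Fin s ⊕ Fin s,
      (Matrix.vandermonde fun i => (X (f i) : MvPowerSeries (Fin s ⊕ Fin s) ℤ)).det
      = ∑ σ : Equiv.Perm (Fin s), (Equiv.Perm.sign σ : ℤ) •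
          monomial (∑ i, Finsupp.single (f i) (σ i : ℕ)) (1 : ℤ) := by
    intro f
    rw [← Matrix.det_transpose, Matrix.det_apply']
    refine Finset.sum_congr rfl fun σ _ => ?_
    rw [zsmul_eq_mul]
    congr 1
    simp only [Matrix.transpose_apply, Matrix.vandermonde_apply, X_pow_eq]
    rw [prod_monomial, Finset.prod_const_one]
  rw [← hleft, det_geomSeries, hvdm, hvdm]
  rw [Finset.sum_mul_sum]
  simp only [smul_mul_smul_comm, monomial_mul_monomial, one_mul]
  simp only [Finset.sum_mul, map_sum, smul_mul_assoc, map_zsmul, smul_eq_mul]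
  refine Finset.sum_congr rfl fun σ _ => Finset.sum_congr rfl fun τ _ => ?_
  congr 1
  rw [coeff_monomial_mul, one_mul, coeff_prod_pairExp]
  set E : Fin s ⊕ Fin s →₀ ℕ := ∑ i, Finsupp.single (Sum.inl i) (σ i : ℕ)
    + ∑ i, Finsupp.single (Sum.inr i) (τ i : ℕ) with hE
  have hEl : ∀ i, E (Sum.inl i) = σ i := by
    intro i
    simp [hE, Finsupp.single_apply]
  have hEr : ∀ i, E (Sum.inr i) = τ i := by
    intro i
    simp [hE, Finsupp.single_apply]
  split_ifs with h
  · congr 2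
    · funext i
      have := h (Sum.inl i)
      rw [Finsupp.tsub_apply, Nat.cast_sub this, hdl, hEl]
    · funext i
      have := h (Sum.inr i)
      rw [Finsupp.tsub_apply, Nat.cast_sub this, hdr, hEr]
  · rw [marginCount_eq_zero, Nat.cast_zero]
    by_contra hcon
    push Not at hcon
    refine h fun b => ?_
    rcases b with i | i
    · rw [hdl, hEl]
      have := hcon.1 i
      omega
    · rw [hdr, hEr]
      have := hcon.2 i
      omega

end Margins

/-! ### Permutation characters of symmetric groups -/

section Coloring

variable (n : ℕ) {s : ℕ}

/-- Maps `{1, ..., n} → {1, ..., s}` with `α_a` points over `a`, for integers `α_a`; there are none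
if some `α_a` is negative. If all `α_a` are natural numbers these are the `α`-tabloids. -/
def Coloring (α : Fin s → ℤ) : Type :=
  {f : Fin n → Fin s // ∀ a, ((Finset.univ.filter fun x => f x = a).card : ℤ) = α a}

instance (α : Fin s → ℤ) : Fintype (Coloring n α) := by
  unfold Coloring
  infer_instance

variable {n} in
theorem card_filter_comp_perm (p : Fin n → Prop) [DecidablePred p] (g : Equiv.Perm (Fin n)) :
    (Finset.univ.filter fun x => p (g x)).card = (Finset.univ.filter p).card :=
  Finset.card_equiv g fun x => by simp

instance (α : Fin s → ℤ) : MulAction (Equiv.Perm (Fin n)) (Coloring n α) where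
  smul g f := ⟨fun x => f.1 (g⁻¹ x), fun a => by
    rw [← f.2 a, card_filter_comp_perm (fun x => f.1 x = a) g⁻¹]⟩
  one_smul f := rfl
  mul_smul g h f := rfl

variable {n}

theorem Coloring.smul_apply {α : Fin s → ℤ} (g : Equiv.Perm (Fin n)) (f : Coloring n α)
    (x : Fin n) : (g • f).1 x = f.1 (g⁻¹ x) := rfl

/-- The value at `g` of the character of the permutation module on `Coloring n α`. -/
def permChar (α : Fin s → ℤ) (g : Equiv.Perm (Fin n)) : ℤ :=
  Nat.card (MulAction.fixedBy (Coloring n α) g)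

theorem permChar_conj (α : Fin s → ℤ) (g h : Equiv.Perm (Fin n)) :
    permChar α (h⁻¹ * g * h) = permChar α g := by
  unfold permChar
  congr 1
  refine Nat.card_congr ((MulAction.toPerm h).subtypeEquiv fun u => ?_)
  rw [MulAction.mem_fixedBy, MulAction.mem_fixedBy, MulAction.toPerm_apply, mul_smul, mul_smul,
    inv_smul_eq_iff]

/-- The number of points over `i` and `j` under a pair of colorings. -/
def jointCount {α β : Fin s → ℤ} (w : Coloring n α × Coloring n β) (p : Fin s × Fin s) : ℕ :=
  (Finset.univ.filter fun x => w.1.1 x = p.1 ∧ w.2.1 x = p.2).card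

theorem jointCount_smul {α β : Fin s → ℤ} (g : Equiv.Perm (Fin n))
    (w : Coloring n α × Coloring n β) : jointCount (g • w) = jointCount w := by
  funext p
  exact card_filter_comp_perm (fun x => w.1.1 x = p.1 ∧ w.2.1 x = p.2) g⁻¹

theorem exists_smul_of_jointCount_eq {α β : Fin s → ℤ} {w w' : Coloring n α × Coloring n β}
    (h : jointCount w = jointCount w') : ∃ g : Equiv.Perm (Fin n), g • w' = w := by
  have e : ∀ p : Fin s × Fin s, Nonempty ({x // (w'.1.1 x, w'.2.1 x) = p}
      ≃ {x // (w.1.1 x, w.2.1 x) = p}) := by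
    intro p
    refine Fintype.card_eq.mp ?_
    have := congrFun h p
    simp only [jointCount] at this
    simp only [Fintype.card_subtype, Prod.ext_iff, this]
  replace e := fun p => (e p).some
  have he : ∀ x, (w.1.1 (Equiv.ofFiberEquiv e x), w.2.1 (Equiv.ofFiberEquiv e x))
      = (w'.1.1 x, w'.2.1 x) := fun x => Equiv.ofFiberEquiv_map e x
  refine ⟨Equiv.ofFiberEquiv e, Prod.ext (Subtype.ext (funext fun x => ?_))
    (Subtype.ext (funext fun x => ?_))⟩
  · have := congrArg Prod.fst (he ((Equiv.ofFiberEquiv e).symm x))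
    rw [Equiv.apply_symm_apply] at this
    exact this.symm
  · have := congrArg Prod.snd (he ((Equiv.ofFiberEquiv e).symm x))
    rw [Equiv.apply_symm_apply] at this
    exact this.symm

/-- Pairs of colorings up to permutation correspond to matrices with the given margins. -/
theorem card_orbits_coloring_prod (α β : Fin s → ℤ) (hα : ∑ i, α i = n) :
    Nat.card (Quotient (MulAction.orbitRel (Equiv.Perm (Fin n)) (Coloring n α × Coloring n β)))
      = marginCount α β := by
  have hF : ∀ w : Coloring n α × Coloring n β,
      (∀ i, ∑ j, (jointCount w (i, j) : ℤ) = α i) ∧ ∀ j, ∑ i, (jointCount w (i, j) : ℤ) = β j := by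
    intro w
    constructor
    · intro i
      rw [← w.1.2 i, ← Nat.cast_sum, Nat.cast_inj,
        Finset.card_eq_sum_card_fiberwise (f := w.2.1) (t := Finset.univ) fun _ _ => by simp]
      simp only [jointCount, Finset.filter_filter]
    · intro j
      rw [← w.2.2 j, ← Nat.cast_sum, Nat.cast_inj,
        Finset.card_eq_sum_card_fiberwise (f := w.1.1) (t := Finset.univ) fun _ _ => by simp]
      simp only [jointCount, Finset.filter_filter, and_comm]
  rw [marginCount]
  refine Nat.card_eq_of_bijective (Quotient.lift (fun w => ⟨jointCount w, hF w⟩) ?_) ⟨?_, ?_⟩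
  · rintro w w' ⟨g, rfl⟩
    exact Subtype.ext (jointCount_smul g w')
  · intro q q'
    refine Quotient.inductionOn₂ q q' fun w w' h => Quotient.sound ?_
    exact exists_smul_of_jointCount_eq (Subtype.ext_iff.mp h)
  · rintro ⟨A, hA, hA'⟩
    have hcard : Fintype.card (Fin n) = Fintype.card (Σ p : Fin s × Fin s, Fin (A p)) := by
      rw [Fintype.card_sigma, Fintype.card_fin, Fintype.sum_prod_type]
      simp only [Fintype.card_fin]
      have : (n : ℤ) = ∑ i, ∑ j, (A (i, j) : ℤ) := by
        rw [← hα]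
        exact Finset.sum_congr rfl fun i _ => (hA i).symm
      exact_mod_cast this
    obtain ⟨e⟩ := Fintype.card_eq.mp hcard
    have hfib : ∀ p, (Finset.univ.filter fun x => (e x).1 = p).card = A p := by
      intro p
      rw [← Fintype.card_subtype, Fintype.card_congr (e.subtypeEquiv (q := fun y => y.1 = p)
        fun x => Iff.rfl), Fintype.card_congr (Equiv.sigmaSubtype p), Fintype.card_fin]
    have h1 : ∀ i, (Finset.univ.filter fun x => (e x).1.1 = i).card = ∑ j, A (i, j) := by
      intro i
      rw [Finset.card_eq_sum_card_fiberwise (f := fun x => (e x).1.2) (t := Finset.univ)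
        fun _ _ => by simp]
      refine Finset.sum_congr rfl fun j _ => ?_
      rw [← hfib, Finset.filter_filter]
      simp only [Prod.ext_iff]
    have h2 : ∀ j, (Finset.univ.filter fun x => (e x).1.2 = j).card = ∑ i, A (i, j) := by
      intro j
      rw [Finset.card_eq_sum_card_fiberwise (f := fun x => (e x).1.1) (t := Finset.univ)
        fun _ _ => by simp]
      refine Finset.sum_congr rfl fun i _ => ?_
      rw [← hfib, Finset.filter_filter]
      simp only [Prod.ext_iff, and_comm]
    refine ⟨Quotient.mk _ (⟨fun x => (e x).1.1, fun i => ?_⟩, ⟨fun x => (e x).1.2, fun j => ?_⟩),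
      Subtype.ext (funext fun p => ?_)⟩
    · rw [h1, ← hA i, Nat.cast_sum]
    · rw [h2, ← hA' j, Nat.cast_sum]
    · change (Finset.univ.filter fun x => (e x).1.1 = p.1 ∧ (e x).1.2 = p.2).card = A p
      rw [← hfib p]
      simp only [Prod.ext_iff]

theorem sum_permChar_mul_permChar (α β : Fin s → ℤ) (hα : ∑ i, α i = n) :
    ∑ g : Equiv.Perm (Fin n), permChar α g * permChar β g
      = (n.factorial : ℤ) * marginCount α β := by
  classical
  have := MulAction.sum_card_fixedBy_eq_card_orbits_mul_card_group (Equiv.Perm (Fin n))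
    (Coloring n α × Coloring n β)
  rw [Fintype.card_perm, Fintype.card_fin, ← Nat.card_eq_fintype_card (α := Quotient _),
    card_orbits_coloring_prod α β hα, mul_comm] at this
  rw [← Nat.cast_mul, ← this, Nat.cast_sum]
  refine Finset.sum_congr rfl fun g _ => ?_
  rw [permChar, permChar, ← Nat.cast_mul, ← Nat.card_prod, ← Nat.card_eq_fintype_card]
  congr 1
  refine Nat.card_congr ⟨fun u => ⟨(u.1.1, u.2.1), ?_⟩, fun w => (⟨w.1.1, ?_⟩, ⟨w.1.2, ?_⟩),
    fun _ => rfl, fun _ => rfl⟩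
  · exact Prod.ext u.1.2 u.2.2
  · exact congrArg Prod.fst w.2
  · exact congrArg Prod.snd w.2

/-- The weight `λ - id + σ`. -/
def shiftedWeight (lam : Fin s → ℕ) (σ : Equiv.Perm (Fin s)) (a : Fin s) : ℤ :=
  (lam a : ℤ) - ((a : ℕ) : ℤ) + ((σ a : ℕ) : ℤ)

theorem sum_shiftedWeight (lam : Fin s → ℕ) (σ : Equiv.Perm (Fin s)) :
    ∑ a, shiftedWeight lam σ a = ((∑ a, lam a : ℕ) : ℤ) := by
  have : ∑ a, ((σ a : ℕ) : ℤ) = ∑ a : Fin s, ((a : ℕ) : ℤ) :=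
    Equiv.sum_comp σ fun a : Fin s => ((a : ℕ) : ℤ)
  simp only [shiftedWeight, Finset.sum_add_distrib, Finset.sum_sub_distrib, this, Nat.cast_sum]
  ring

/-- The virtual character `det (φ_{λ_a - a + b})` of the symmetric group. -/
def detChar (lam : Fin s → ℕ) (g : Equiv.Perm (Fin n)) : ℤ :=
  ∑ σ : Equiv.Perm (Fin s), (Equiv.Perm.sign σ : ℤ) * permChar (shiftedWeight lam σ) g

/-- The virtual character `det (φ_{λ_a - a + b})` has norm one. -/
theorem sum_detChar_sq (lam : Fin s → ℕ) (hlam : Antitone lam) (hn : ∑ a, lam a = n) :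
    ∑ g : Equiv.Perm (Fin n), detChar lam g * detChar lam g = n.factorial := by
  -- The exponents `λ_a + s - 1 - a` are distinct. Reversing the order of `0, ..., s - 1` in both
  -- permutations does not change the product of the signs.
  let a : Fin s → ℕ := fun i => lam i + (Fin.rev i : ℕ)
  have ha : Function.Injective a := by
    refine StrictAnti.injective fun i j hij => ?_
    have h1 := hlam hij.le
    have h2 : (Fin.rev j : ℕ) < Fin.rev i := Fin.rev_lt_rev.mpr hij
    simp only [a]
    omega
  have hrev : ∀ σ : Equiv.Perm (Fin s),
      (fun i => (a i : ℤ) - ((Fin.revPerm * σ : Equiv.Perm (Fin s)) i : ℕ))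
         = shiftedWeight lam σ := by
    intro σ
    funext i
    have h1 := Fin.val_rev i
    have h2 := Fin.val_rev (σ i)
    have h3 := i.2
    have h4 := (σ i).2
    simp only [a, shiftedWeight, Equiv.Perm.mul_apply, Fin.revPerm_apply]
    omega
  have key := sum_sign_mul_marginCount a ha
  rw [← Equiv.sum_comp (Equiv.mulLeft (Fin.revPerm : Equiv.Perm (Fin s)))] at key
  simp_rw [← Equiv.sum_comp (Equiv.mulLeft (Fin.revPerm : Equiv.Perm (Fin s)))
    fun τ : Equiv.Perm (Fin s) => ((Equiv.Perm.sign _ : ℤ) * (Equiv.Perm.sign τ : ℤ)) *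
      (marginCount _ fun j => (a j : ℤ) - (τ j : ℕ) : ℤ)] at key
  have hs : ∀ σ τ : Equiv.Perm (Fin s),
      (Equiv.Perm.sign (Fin.revPerm * σ) : ℤ) * (Equiv.Perm.sign (Fin.revPerm * τ) : ℤ)
        = (Equiv.Perm.sign σ : ℤ) * (Equiv.Perm.sign τ : ℤ) := by
    intro σ τ
    rw [map_mul, map_mul, Units.val_mul, Units.val_mul, mul_mul_mul_comm, ← Units.val_mul,
      Int.units_mul_self, Units.val_one, one_mul]
  simp only [Equiv.coe_mulLeft, hs] at key
  calc ∑ g : Equiv.Perm (Fin n), detChar lam g * detChar lam g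
      = ∑ σ : Equiv.Perm (Fin s), ∑ τ : Equiv.Perm (Fin s),
        ((Equiv.Perm.sign σ : ℤ) * (Equiv.Perm.sign τ : ℤ)) *
          ∑ g : Equiv.Perm (Fin n),
            permChar (shiftedWeight lam σ) g * permChar (shiftedWeight lam τ) g := by
        simp_rw [detChar, Finset.sum_mul_sum, Finset.mul_sum]
        rw [Finset.sum_comm]
        refine Finset.sum_congr rfl fun σ _ => ?_
        rw [Finset.sum_comm]
        exact Finset.sum_congr rfl fun τ _ => Finset.sum_congr rfl fun g _ => by ring
    _ = (n.factorial : ℤ) * ∑ σ : Equiv.Perm (Fin s), ∑ τ : Equiv.Perm (Fin s),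
        ((Equiv.Perm.sign σ : ℤ) * (Equiv.Perm.sign τ : ℤ)) *
          marginCount (shiftedWeight lam σ) (shiftedWeight lam τ) := by
        simp only [Finset.mul_sum]
        refine Finset.sum_congr rfl fun σ _ => Finset.sum_congr rfl fun τ _ => ?_
        rw [← Finset.mul_sum, sum_permChar_mul_permChar _ _ (by rw [sum_shiftedWeight, hn])]
        ring
    _ = n.factorial := by
        simp_rw [← hrev]
        rw [key, mul_one]

end Coloring

/-! ### Tableaux and tabloids -/

section Tableaux

theorem sum_range_le_sum_of_finset (A : Finset ℕ) :
    ∑ j ∈ Finset.range A.card, j ≤ ∑ x ∈ A, x ∧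
      (∑ j ∈ Finset.range A.card, j = ∑ x ∈ A, x → ∀ x ∈ A, x < A.card) := by
  let f := A.orderEmbOfFin rfl
  have hle : ∀ i : Fin A.card, (i : ℕ) ≤ f i := by
    rintro ⟨i, hi⟩
    induction i with
    | zero => exact Nat.zero_le _
    | succ i ih =>
      have h1 := ih (by omega)
      have h2 : f ⟨i, by omega⟩ < f ⟨i + 1, hi⟩ := f.strictMono (Fin.mk_lt_mk.mpr (by omega))
      simp only at h1 ⊢
      omega
  have hsum : ∑ x ∈ A, x = ∑ i, f i :=
    (congrArg (fun B : Finset ℕ => ∑ x ∈ B, x) (Finset.image_orderEmbOfFin_univ A rfl)).symm.trans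
      (Finset.sum_image fun _ _ _ _ h => f.injective h)
  rw [← Fin.sum_univ_eq_sum_range fun i => i, hsum]
  refine ⟨Finset.sum_le_sum fun i _ => hle i, fun h x hx => ?_⟩
  have heq := (Finset.sum_eq_sum_iff_of_le fun i _ => hle i).mp h
  rw [← Finset.mem_coe, ← Finset.range_orderEmbOfFin A rfl] at hx
  obtain ⟨i, rfl⟩ := hx
  have := heq i (Finset.mem_univ i)
  change f i < _
  omega

variable {n s : ℕ}

/-- If the points of each fibre of `w` have distinct columns, then the sum of all columns is at
least `∑ m (m - 1) / 2`, with `m` the cardinalities of the fibres; when equality holds the points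
over `a` have the columns `0, ..., m_a - 1`. -/
theorem sum_column_of_injective (w : Fin n → Fin s) (col : Fin n → ℕ)
    (hinj : ∀ x y, w x = w y → col x = col y → x = y) :
    ∑ a, ∑ j ∈ Finset.range (Finset.univ.filter fun x => w x = a).card, j ≤ ∑ x, col x ∧
      (∑ a, ∑ j ∈ Finset.range (Finset.univ.filter fun x => w x = a).card, j = ∑ x, col x →
        ∀ x, col x < (Finset.univ.filter fun y => w y = w x).card) := by
  have hcard : ∀ a, ((Finset.univ.filter fun x => w x = a).image col).card
      = (Finset.univ.filter fun x => w x = a).card := fun a =>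
    Finset.card_image_of_injOn fun x hx y hy h => by
      simp only [Finset.coe_filter, Finset.mem_univ, true_and, Set.mem_ofPred_eq] at hx hy
      exact hinj x y (hx.trans hy.symm) h
  have hsum : ∀ a, ∑ c ∈ (Finset.univ.filter fun x => w x = a).image col, c
      = ∑ x ∈ Finset.univ.filter fun x => w x = a, col x := fun a =>
    Finset.sum_image fun x hx y hy h => by
      simp only [Finset.coe_filter, Finset.mem_univ, true_and, Set.mem_ofPred_eq] at hx hy
      exact hinj x y (hx.trans hy.symm) h
  have hle : ∀ a, ∑ j ∈ Finset.range (Finset.univ.filter fun x => w x = a).card, j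
      ≤ ∑ x ∈ Finset.univ.filter fun x => w x = a, col x := fun a => by
    rw [← hcard, ← hsum]
    exact (sum_range_le_sum_of_finset _).1
  rw [← Finset.sum_fiberwise Finset.univ w col]
  refine ⟨Finset.sum_le_sum fun a _ => hle a, fun h x => ?_⟩
  have heq := (Finset.sum_eq_sum_iff_of_le fun a _ => hle a).mp h (w x) (Finset.mem_univ _)
  rw [← hcard, ← hsum] at heq
  rw [← hcard]
  exact (sum_range_le_sum_of_finset _).2 heq _ (Finset.mem_image_of_mem _ (by simp))

variable {lam : Fin s → ℕ} (t : Tableau n lam)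

/-- The column of the tableau `t` that contains `x`. -/
def Tableau.col (x : Fin n) : ℕ := ((t.symm x).2 : ℕ)

theorem Tableau.col_apply (c : Σ a : Fin s, Fin (lam a)) : t.col (t c) = c.2 :=
  congrArg (fun c : Σ a : Fin s, Fin (lam a) => (c.2 : ℕ)) (t.symm_apply_apply c)

theorem Tableau.sum_col : ∑ x, t.col x = ∑ a, ∑ j ∈ Finset.range (lam a), j := by
  rw [← Equiv.sum_comp t, Fintype.sum_sigma]
  refine Finset.sum_congr rfl fun a _ => ?_
  rw [← Fin.sum_univ_eq_sum_range fun i => i]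
  simp only [Tableau.col_apply]

/-- The column stabilizer `C_t`. -/
def Tableau.colStab : Subgroup (Equiv.Perm (Fin n)) where
  carrier := {π | t.InColStab π}
  mul_mem' {π ρ} hπ hρ x := (hπ (ρ x)).trans (hρ x)
  one_mem' x := rfl
  inv_mem' {π} hπ x := by
    have := hπ (π⁻¹ x)
    rw [show π (π⁻¹ x) = x from π.apply_symm_apply x] at this
    exact this.symm

theorem Tableau.swap_mem_colStab {x y : Fin n} (h : t.col x = t.col y) :
    Equiv.swap x y ∈ t.colStab := by
  intro z
  change t.col _ = t.col _
  rw [Equiv.swap_apply_def]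
  split_ifs with h1 h2
  · rw [h1, h]
  · rw [h2, h]
  · rfl

theorem Tabloid.smul_apply (g : Equiv.Perm (Fin n)) (f : Tabloid n lam) (x : Fin n) :
    (g • f).1 x = f.1 (g⁻¹ x) := rfl

theorem Tabloid.card_filter (f : Tabloid n lam) (a : Fin s) :
    (Finset.univ.filter fun x => f.1 x = a).card = lam a := by
  rw [← f.2 a, Nat.card_eq_fintype_card, Fintype.card_subtype]

instance : Fintype (Tabloid n lam) := by
  classical
  unfold Tabloid
  infer_instance

theorem comp_swap_inv {α : Type*} (f : Fin n → α) {x y : Fin n} (h : f x = f y) (z : Fin n) :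
    f ((Equiv.swap x y)⁻¹ z) = f z := by
  rw [Equiv.swap_inv, Equiv.swap_apply_def]
  split_ifs with h1 h2
  · rw [h1, h]
  · rw [h2, h]
  · rfl

/-- A tabloid with no two entries in the same row and in the same column of `t` is obtained from
the tabloid of `t` by a column permutation. -/
theorem Tableau.tabloid_cover (u : Tabloid n lam) :
    (∃ c ∈ t.colStab, Equiv.Perm.sign c = -1 ∧ c • u = u) ∨
      ∃ c ∈ t.colStab, u = c • t.tabloid := by
  by_cases h : ∃ x y, x ≠ y ∧ u.1 x = u.1 y ∧ t.col x = t.col y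
  · obtain ⟨x, y, hxy, hu, hc⟩ := h
    exact Or.inl ⟨Equiv.swap x y, t.swap_mem_colStab hc, Equiv.Perm.sign_swap hxy,
      Subtype.ext (funext fun z => comp_swap_inv u.1 hu z)⟩
  · right
    have hinj : ∀ x y, u.1 x = u.1 y → t.col x = t.col y → x = y := fun x y hu hc => by
      by_contra hxy
      exact h ⟨x, y, hxy, hu, hc⟩
    have hlt : ∀ x, t.col x < lam (u.1 x) := by
      have := (sum_column_of_injective u.1 t.col hinj).2
      simp only [Tabloid.card_filter] at this
      exact this t.sum_col.symm
    let p : Fin n → Fin n := fun x => t ⟨u.1 x, ⟨t.col x, hlt x⟩⟩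
    have hp1 : ∀ x, (t.symm (p x)).1 = u.1 x := fun x => by simp [p]
    have hp2 : ∀ x, t.col (p x) = t.col x := fun x => t.col_apply _
    have hp : Function.Injective p := fun x y hxy => hinj x y
      (by rw [← hp1 x, ← hp1 y, hxy]) (by rw [← hp2 x, ← hp2 y, hxy])
    let π : Equiv.Perm (Fin n) := Equiv.ofBijective p (Finite.injective_iff_bijective.mp hp)
    refine ⟨π⁻¹, t.colStab.inv_mem (show π ∈ t.colStab from hp2), Subtype.ext (funext fun x => ?_)⟩
    rw [Tabloid.smul_apply, inv_inv]
    exact (hp1 x).symm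

open Classical in
/-- The coefficient of the tabloid `u` in the polytabloid `e_t`. -/
def Tableau.polyCoeff (u : Tabloid n lam) : ℤ :=
  ∑ π : Equiv.Perm (Fin n),
    if π ∈ t.colStab ∧ π • t.tabloid = u then (Equiv.Perm.sign π : ℤ) else 0

theorem Tableau.isAltGenerator :
    IsAltGenerator t.colStab Equiv.Perm.sign t.tabloid t.polyCoeff where
  alt c hc u := by
    unfold Tableau.polyCoeff
    rw [Finset.mul_sum, ← Equiv.sum_comp (Equiv.mulLeft c)]
    refine Finset.sum_congr rfl fun π _ => ?_
    rw [Equiv.coe_mulLeft, Subgroup.mul_mem_cancel_left _ hc, mul_smul, smul_left_cancel_iff,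
      mul_ite, mul_zero, map_mul, Units.val_mul]
  base := by
    unfold Tableau.polyCoeff
    rw [Finset.sum_eq_single 1]
    · rw [if_pos ⟨t.colStab.one_mem, one_smul _ _⟩]; simp
    · rintro π - hπ
      refine if_neg fun ⟨h1, h2⟩ => hπ (Equiv.ext fun x => t.symm.injective ?_)
      have h3 := congrFun (Subtype.ext_iff.mp h2) (π x)
      rw [Tabloid.smul_apply, show π⁻¹ (π x) = x from π.symm_apply_apply x] at h3
      have h4 : (t.symm (π x)).1 = (t.symm x).1 := h3.symm
      have h5 : ((t.symm (π x)).2 : ℕ) = ((t.symm x).2 : ℕ) := h1 x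
      rw [Equiv.Perm.one_apply]
      exact Sigma.ext h4 ((Fin.heq_ext_iff (by rw [h4])).mpr h5)
    · simp
  cover := t.tabloid_cover

/-- The rearrangement inequality: replacing `λ` by `λ - id + σ` increases the sum of squares. -/
theorem sum_sq_lt_sum_shiftedWeight_sq (hlam : Antitone lam) {σ : Equiv.Perm (Fin s)}
    (hσ : σ ≠ 1) : ∑ a, (lam a : ℤ) ^ 2 < ∑ a, shiftedWeight lam σ a ^ 2 := by
  let ν : Fin s → ℤ := fun a => (lam a : ℤ) - ((a : ℕ) : ℤ)
  let ι : Fin s → ℤ := fun a => ((a : ℕ) : ℤ)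
  have hν : StrictAnti ν := fun a b hab => by
    have h1 := hlam hab.le
    have h2 : (a : ℕ) < b := hab
    simp only [ν]
    omega
  have hanti : Antivary ν ι := fun a b hab => by
    have : a < b := by simpa [ι] using hab
    exact (hν this).le
  have hlt : ∑ a, ν a * ι a < ∑ a, ν a * ι (σ a) := by
    refine hanti.sum_mul_lt_sum_mul_comp_perm_iff.mpr fun h => hσ ?_
    have hmono : StrictMono σ := by
      refine Monotone.strictMono_of_injective (fun a b hab => ?_) σ.injective
      by_contra hcon
      push Not at hcon
      have h1 : ι (σ b) < ι (σ a) := by simpa [ι] using hcon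
      have h2 := h h1
      rcases hab.eq_or_lt with rfl | hab
      · exact lt_irrefl _ hcon
      · exact absurd (hν hab) (not_lt.mpr h2)
    refine Equiv.ext fun a => congrFun ((hmono.range_inj strictMono_id).mp ?_) a
    rw [σ.surjective.range_eq, Set.range_id]
  have hι : ∑ a, ι (σ a) ^ 2 = ∑ a, ι a ^ 2 := Equiv.sum_comp σ fun a => ι a ^ 2
  have e1 : ∑ a, (lam a : ℤ) ^ 2 = ∑ a, ν a ^ 2 + 2 * ∑ a, ν a * ι a + ∑ a, ι a ^ 2 := by
    rw [Finset.mul_sum, ← Finset.sum_add_distrib, ← Finset.sum_add_distrib]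
    refine Finset.sum_congr rfl fun a _ => ?_
    simp only [ν, ι]; ring
  have e2 : ∑ a, shiftedWeight lam σ a ^ 2
      = ∑ a, ν a ^ 2 + 2 * ∑ a, ν a * ι (σ a) + ∑ a, ι (σ a) ^ 2 := by
    rw [Finset.mul_sum, ← Finset.sum_add_distrib, ← Finset.sum_add_distrib]
    refine Finset.sum_congr rfl fun a _ => ?_
    simp only [ν, ι, shiftedWeight]; ring
  rw [e1, e2, hι]
  linarith

theorem two_mul_sum_range (m : ℕ) : 2 * ((∑ j ∈ Finset.range m, j : ℕ) : ℤ) = (m : ℤ) ^ 2 - m := by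
  induction m with
  | zero => simp
  | succ m ih => rw [Finset.sum_range_succ, Nat.cast_add, mul_add, ih]; push_cast; ring

/-- A coloring of weight `λ - id + σ` with `σ ≠ 1` has two points of the same colour in the same
column of `t`. -/
theorem Tableau.exists_colStab_fixing (hlam : Antitone lam) {σ : Equiv.Perm (Fin s)}
    (hσ : σ ≠ 1) (f : Coloring n (shiftedWeight lam σ)) :
    ∃ c ∈ t.colStab, Equiv.Perm.sign c = -1 ∧ c • f = f := by
  by_cases h : ∃ x y, x ≠ y ∧ f.1 x = f.1 y ∧ t.col x = t.col y
  · obtain ⟨x, y, hxy, hu, hc⟩ := h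
    exact ⟨Equiv.swap x y, t.swap_mem_colStab hc, Equiv.Perm.sign_swap hxy,
      Subtype.ext (funext fun z => comp_swap_inv f.1 hu z)⟩
  · exfalso
    have hinj : ∀ x y, f.1 x = f.1 y → t.col x = t.col y → x = y := fun x y hu hc => by
      by_contra hxy
      exact h ⟨x, y, hxy, hu, hc⟩
    have h1 := (sum_column_of_injective f.1 t.col hinj).1
    rw [t.sum_col] at h1
    have h2 : ∑ a,
        (2 * ((∑ j ∈ Finset.range (Finset.univ.filter fun x => f.1 x = a).card, j : ℕ) : ℤ))
        ≤ ∑ a, 2 * ((∑ j ∈ Finset.range (lam a), j : ℕ) : ℤ) := by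
      rw [← Finset.mul_sum, ← Finset.mul_sum, ← Nat.cast_sum, ← Nat.cast_sum]
      exact_mod_cast Nat.mul_le_mul_left 2 h1
    simp only [two_mul_sum_range, f.2, Finset.sum_sub_distrib, sum_shiftedWeight] at h2
    have h3 := sum_sq_lt_sum_shiftedWeight_sq hlam hσ
    push_cast at h2
    linarith

end Tableaux

/-! ### The character of the Specht module -/

section Specht

variable {n s : ℕ} {lam : Fin s → ℕ}

theorem trace_eq_sum_coeff
    (f : MonoidAlgebra ℂ (Tabloid n lam) →ₗ[ℂ] MonoidAlgebra ℂ (Tabloid n lam)) :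
    LinearMap.trace ℂ _ f = ∑ u, (f (MonoidAlgebra.single u 1)).coeff u := by
  classical
  rw [LinearMap.trace_eq_matrix_trace ℂ (MonoidAlgebra.basis (Tabloid n lam) ℂ), Matrix.trace]
  refine Finset.sum_congr rfl fun u _ => ?_
  rw [Matrix.diag_apply, LinearMap.toMatrix_apply, MonoidAlgebra.basis_apply]
  rfl

instance : Module.Finite ℂ (MonoidAlgebra ℂ (Tabloid n lam)) :=
  Module.Finite.of_basis (MonoidAlgebra.basis (Tabloid n lam) ℂ)

/-- Tabloids are colorings whose weight consists of natural numbers. -/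
def tabloidEquivColoring (n : ℕ) {s : ℕ} (lam : Fin s → ℕ) :
    Tabloid n lam ≃ Coloring n fun a => (lam a : ℤ) where
  toFun f := ⟨f.1, fun a => by rw [f.card_filter]⟩
  invFun f := ⟨f.1, fun a => by
    rw [Nat.card_eq_fintype_card, Fintype.card_subtype]; exact Int.natCast_inj.mp (f.2 a)⟩
  left_inv _ := rfl
  right_inv _ := rfl

theorem card_fixedBy_tabloid (g : Equiv.Perm (Fin n)) :
    (Nat.card (MulAction.fixedBy (Tabloid n lam) g) : ℤ) = permChar (fun a => (lam a : ℤ)) g := by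
  rw [permChar]
  congr 1
  refine Nat.card_congr ((tabloidEquivColoring n lam).subtypeEquiv fun u => ?_)
  rw [MulAction.mem_fixedBy, MulAction.mem_fixedBy, ← (tabloidEquivColoring n lam).injective.eq_iff]
  rfl

theorem permModule_character (g : Equiv.Perm (Fin n)) :
    (permModule n lam).character g = (permChar (fun a => (lam a : ℤ)) g : ℂ) := by
  classical
  rw [Representation.character, trace_eq_sum_coeff, ← card_fixedBy_tabloid, card_fixedBy_eq_sum]
  push_cast
  refine Finset.sum_congr rfl fun u _ => ?_
  rw [Representation.ofMulAction_single, MonoidAlgebra.coeff_single, Finsupp.single_apply]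
  exact if_congr (by rw [inv_smul_eq_iff, eq_comm]) rfl rfl

theorem shiftedWeight_one (lam : Fin s → ℕ) : shiftedWeight lam 1 = fun a => (lam a : ℤ) := by
  funext a
  simp [shiftedWeight]

variable (t : Tableau n lam)

theorem Tableau.coeff_polytabloid (u : Tabloid n lam) :
    t.polytabloid.coeff u = (t.polyCoeff u : ℂ) := by
  classical
  unfold Tableau.polytabloid Tableau.polyCoeff
  rw [MonoidAlgebra.coeff_sum, Finsupp.finsetSum_apply, Int.cast_sum]
  refine Finset.sum_congr rfl fun π _ => ?_
  by_cases h : t.InColStab π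
  · have h' : π ∈ t.colStab := h
    rw [if_pos h, MonoidAlgebra.coeff_single, Finsupp.single_apply]
    simp only [h', true_and]
    split_ifs <;> simp
  · have h' : π ∉ t.colStab := h
    rw [if_neg h, if_neg fun hc => h' hc.1]
    simp

/-- The operator `m ↦ ∑_h ⟨h e_t, m⟩ h e_t`, a multiple of the orthogonal projection of `M^λ` to
the Specht module. -/
def Tableau.gramMap :
    MonoidAlgebra ℂ (Tabloid n lam) →ₗ[ℂ] MonoidAlgebra ℂ (Tabloid n lam) :=
  ∑ h : Equiv.Perm (Fin n), LinearMap.smulRight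
    (∑ u, (t.polyCoeff (h⁻¹ • u) : ℂ) •
      (Finsupp.lapply u ∘ₗ (MonoidAlgebra.coeffLinearEquiv ℂ).toLinearMap))
    (permModule n lam h t.polytabloid)

theorem Tableau.gramMap_apply (m : MonoidAlgebra ℂ (Tabloid n lam)) :
    t.gramMap m = ∑ h : Equiv.Perm (Fin n),
      (∑ u, (t.polyCoeff (h⁻¹ • u) : ℂ) * m.coeff u) • permModule n lam h t.polytabloid := by
  simp [Tableau.gramMap]

theorem Tableau.exists_perm (t t' : Tableau n lam) : ∃ g, t' = t.perm g :=
  ⟨t.symm.trans t', by ext x; simp [Tableau.perm]⟩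

theorem Tableau.gramMap_mem (m : MonoidAlgebra ℂ (Tabloid n lam)) :
    t.gramMap m ∈ (spechtModule n lam).toSubmodule := by
  rw [t.gramMap_apply]
  refine Submodule.sum_mem _ fun h _ => Submodule.smul_mem _ _ ?_
  rw [t.apply_polytabloid]
  exact Submodule.subset_span ⟨_, rfl⟩

theorem Tableau.coeff_perm_polytabloid (g : Equiv.Perm (Fin n)) (u : Tabloid n lam) :
    (permModule n lam g t.polytabloid).coeff u = (t.polyCoeff (g⁻¹ • u) : ℂ) := by
  rw [Representation.coeff_ofMulAction, t.coeff_polytabloid]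

/-- The Gram operator acts on the Specht module as a scalar. -/
theorem Tableau.gramMap_of_mem {m : MonoidAlgebra ℂ (Tabloid n lam)}
    (hm : m ∈ (spechtModule n lam).toSubmodule) :
    t.gramMap m = (altScalar (Equiv.Perm (Fin n)) t.tabloid t.polyCoeff : ℂ) • m := by
  change m ∈ Submodule.span ℂ (Set.range (Tableau.polytabloid (n := n) (lam := lam))) at hm
  induction hm using Submodule.span_induction with
  | zero => simp
  | add x y _ _ hx hy => rw [map_add, hx, hy, smul_add]
  | smul a x _ hx => rw [map_smul, hx, smul_comm]
  | mem x hx =>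
    obtain ⟨t', rfl⟩ := hx
    obtain ⟨k, rfl⟩ := t.exists_perm t'
    rw [← t.apply_polytabloid]
    ext w
    rw [t.gramMap_apply, MonoidAlgebra.coeff_sum, Finsupp.finsetSum_apply]
    simp only [MonoidAlgebra.coeff_smul, Finsupp.smul_apply, t.coeff_perm_polytabloid, smul_eq_mul]
    have key : ∀ h : Equiv.Perm (Fin n),
        ∑ u, t.polyCoeff (h⁻¹ • u) * t.polyCoeff (k⁻¹ • u) = matCoeff t.polyCoeff (k⁻¹ * h) := by
      intro h
      rw [matCoeff, ← Equiv.sum_comp (MulAction.toPerm k)]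
      refine Finset.sum_congr rfl fun u _ => ?_
      rw [MulAction.toPerm_apply, inv_smul_smul, mul_inv_rev, inv_inv, mul_smul, mul_comm]
    have h2 := t.isAltGenerator.sum_matCoeff_mul (k⁻¹ • w)
    rw [← Equiv.sum_comp (Equiv.mulLeft k⁻¹)] at h2
    simp only [Equiv.coe_mulLeft, ← key, mul_inv_rev, inv_inv, mul_smul, smul_inv_smul] at h2
    exact_mod_cast h2

/-- The character of the Specht module as an average of matrix coefficients of `e_t`. -/
theorem Tableau.altScalar_mul_character (g : Equiv.Perm (Fin n)) :
    (altScalar (Equiv.Perm (Fin n)) t.tabloid t.polyCoeff : ℂ)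
      * (spechtModule n lam).toRepresentation.character g = (avgCoeff t.polyCoeff g : ℂ) := by
  have hmem : ∀ m, (permModule n lam g ∘ₗ t.gramMap) m ∈ (spechtModule n lam).toSubmodule :=
    fun m => (spechtModule n lam).apply_mem_toSubmodule g (t.gramMap_mem m)
  have h1 := LinearMap.trace_restrict_eq_of_forall_mem (spechtModule n lam).toSubmodule _ hmem
  have h2 : (permModule n lam g ∘ₗ t.gramMap).restrict (fun x _ => hmem x)
      = (altScalar (Equiv.Perm (Fin n)) t.tabloid t.polyCoeff : ℂ)
        • (spechtModule n lam).toRepresentation g := by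
    ext1 x
    apply Subtype.ext
    change permModule n lam g (t.gramMap x.1) = _ • permModule n lam g x.1
    rw [t.gramMap_of_mem x.2, map_smul]
  rw [h2, map_smul, smul_eq_mul] at h1
  rw [Representation.character, h1, trace_eq_sum_coeff]
  have h3 : avgCoeff t.polyCoeff g = ∑ u, ∑ h : Equiv.Perm (Fin n),
      t.polyCoeff (h⁻¹ • u) * t.polyCoeff (h⁻¹ • g⁻¹ • u) := by
    rw [avgCoeff, Finset.sum_comm]
    refine Finset.sum_congr rfl fun h _ => ?_
    rw [matCoeff, ← Equiv.sum_comp (MulAction.toPerm h) fun u =>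
      t.polyCoeff (h⁻¹ • u) * t.polyCoeff (h⁻¹ • g⁻¹ • u)]
    refine Finset.sum_congr rfl fun u _ => ?_
    simp only [MulAction.toPerm_apply, inv_smul_smul, mul_inv_rev, inv_inv, mul_smul]
  rw [h3]
  push_cast
  refine Finset.sum_congr rfl fun u _ => ?_
  change (permModule n lam g (t.gramMap (MonoidAlgebra.single u 1))).coeff u = _
  rw [Representation.coeff_ofMulAction, t.gramMap_apply,
    MonoidAlgebra.coeff_sum, Finsupp.finsetSum_apply]
  refine Finset.sum_congr rfl fun h _ => ?_
  rw [MonoidAlgebra.coeff_smul, Finsupp.smul_apply, t.coeff_perm_polytabloid, smul_eq_mul]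
  congr 1
  rw [Finset.sum_eq_single u]
  · simp
  · intro b _ hb
    simp [hb.symm]
  · simp

/-- **Determinantal formula** for the characters of the Specht modules. Both sides have norm one,
and their scalar product is one as well. -/
theorem spechtModule_character (hlam : Antitone lam) (hn : ∑ a, lam a = n)
    (g : Equiv.Perm (Fin n)) :
    (spechtModule n lam).toRepresentation.character g = (detChar lam g : ℂ) := by
  obtain ⟨t⟩ : Nonempty (Tableau n lam) := Fintype.card_eq.mp (by simp [hn])
  set c := altScalar (Equiv.Perm (Fin n)) t.tabloid t.polyCoeff with hc
  have hcpos : 0 < c := t.isAltGenerator.altScalar_pos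
  have hcard : (Fintype.card (Equiv.Perm (Fin n)) : ℤ) = n.factorial := by
    rw [Fintype.card_perm, Fintype.card_fin]
  have hterm : ∀ σ : Equiv.Perm (Fin s),
      ∑ g : Equiv.Perm (Fin n), avgCoeff t.polyCoeff g * permChar (shiftedWeight lam σ) g
        = if σ = 1 then (n.factorial : ℤ) * c else 0 := by
    intro σ
    rw [sum_avgCoeff_mul _ fun g h => permChar_conj _ g h, hcard]
    split_ifs with hσ
    · rw [hσ, shiftedWeight_one, hc, ← t.isAltGenerator.sum_matCoeff_mul_fixed]
      simp_rw [card_fixedBy_tabloid]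
    · have := sum_matCoeff_mul_fixed_eq_zero t.isAltGenerator.alt
        (t.exists_colStab_fixing hlam hσ)
      unfold permChar
      rw [this, mul_zero]
  have hmix : ∑ g : Equiv.Perm (Fin n), avgCoeff t.polyCoeff g * detChar lam g
      = n.factorial * c := by
    simp only [detChar, Finset.mul_sum]
    rw [Finset.sum_comm]
    simp only [mul_left_comm (avgCoeff _ _), ← Finset.mul_sum, hterm]
    simp
  have hzero : ∑ g : Equiv.Perm (Fin n), (avgCoeff t.polyCoeff g - c * detChar lam g) ^ 2 = 0 := by
    have e : ∀ g : Equiv.Perm (Fin n), (avgCoeff t.polyCoeff g - c * detChar lam g) ^ 2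
        = avgCoeff t.polyCoeff g * avgCoeff t.polyCoeff g
          - 2 * c * (avgCoeff t.polyCoeff g * detChar lam g)
          + c ^ 2 * (detChar lam g * detChar lam g) := fun g => by ring
    simp only [e, Finset.sum_add_distrib, Finset.sum_sub_distrib, ← Finset.mul_sum, hmix,
      sum_detChar_sq lam hlam hn, t.isAltGenerator.sum_avgCoeff_sq, hcard, ← hc]
    ring
  have hg := (Finset.sum_eq_zero_iff_of_nonneg fun g _ => sq_nonneg _).mp hzero g
    (Finset.mem_univ g)
  have hg' : avgCoeff t.polyCoeff g = c * detChar lam g := by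
    have := pow_eq_zero_iff (two_ne_zero) |>.mp hg
    linarith
  have h1 := t.altScalar_mul_character g
  rw [hg', ← hc, Int.cast_mul] at h1
  exact mul_left_cancel₀ (Int.cast_ne_zero.mpr hcpos.ne') h1

end Specht

/-! ### Permutation characters in terms of cycle types -/

section Cycles

/-- The number of maps `f : ι → {1, ..., s}` for which the weights `μ_j` over `a` add up to `α_a`,
for all `a`. -/
def assignCount {ι : Type*} [Fintype ι] {s : ℕ} (μ : ι → ℕ) (α : Fin s → ℤ) : ℕ :=
  Nat.card {f : ι → Fin s // ∀ a, ((∑ j, if f j = a then μ j else 0 : ℕ) : ℤ) = α a}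

theorem exists_equiv_of_map_univ_eq {ι κ : Type*} [Fintype ι] [Fintype κ] {f : ι → ℕ} {g : κ → ℕ}
    (h : Finset.univ.val.map f = Finset.univ.val.map g) : ∃ e : κ ≃ ι, ∀ z, f (e z) = g z := by
  have e : ∀ m, Nonempty ({z // g z = m} ≃ {j // f j = m}) := by
    intro m
    refine Fintype.card_eq.mp ?_
    have := congrArg (Multiset.count m) h
    rw [Multiset.count_map, Multiset.count_map] at this
    rw [Fintype.card_subtype, Fintype.card_subtype, Finset.card_def, Finset.card_def,
      Finset.filter_val, Finset.filter_val]
    simpa [eq_comm] using this.symm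
  exact ⟨Equiv.ofFiberEquiv fun m => (e m).some, fun z => Equiv.ofFiberEquiv_map _ z⟩

variable {n : ℕ} (g : Equiv.Perm (Fin n))

/-- The index type of the orbits of `g`: the nontrivial cycles and the fixed points. -/
abbrev CycleIndex : Type := g.cycleFactorsFinset ⊕ {x // g x = x}

/-- The orbit that contains `x`. -/
def cycleIndex (x : Fin n) : CycleIndex g :=
  if h : g x = x then Sum.inr ⟨x, h⟩
  else Sum.inl ⟨g.cycleOf x,
    Equiv.Perm.cycleOf_mem_cycleFactorsFinset_iff.mpr (Equiv.Perm.mem_support.mpr h)⟩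

/-- The length of an orbit. -/
def cycleLength : CycleIndex g → ℕ := Sum.elim (fun c => c.1.support.card) fun _ => 1

theorem cycleIndex_eq_inl {x : Fin n} {c : g.cycleFactorsFinset} :
    cycleIndex g x = Sum.inl c ↔ x ∈ c.1.support := by
  unfold cycleIndex
  split_ifs with h
  · simp only [false_iff]
    intro hx
    exact Equiv.Perm.mem_support.mp (Equiv.Perm.mem_cycleFactorsFinset_support_le c.2 hx) h
  · rw [Sum.inl.injEq, Subtype.ext_iff]
    constructor
    · intro hc
      rw [← hc]
      exact Equiv.Perm.mem_support_cycleOf_iff.mpr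
        ⟨Equiv.Perm.SameCycle.refl g x, Equiv.Perm.mem_support.mpr h⟩
    · intro hx
      exact (Equiv.Perm.cycle_is_cycleOf hx c.2).symm

theorem cycleIndex_eq_inr {x : Fin n} {y : {x // g x = x}} :
    cycleIndex g x = Sum.inr y ↔ x = y := by
  unfold cycleIndex
  split_ifs with h
  · rw [Sum.inr.injEq, Subtype.ext_iff]
  · simp only [false_iff]
    rintro rfl
    exact h y.2

theorem card_cycleIndex_fiber (z : CycleIndex g) :
    (Finset.univ.filter fun x => cycleIndex g x = z).card = cycleLength g z := by
  rcases z with c | y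
  · simp only [cycleIndex_eq_inl, cycleLength, Sum.elim_inl]
    congr 1
    ext x
    simp
  · simp only [cycleIndex_eq_inr, cycleLength, Sum.elim_inr]
    rw [Finset.card_eq_one]
    exact ⟨y, by ext x; simp⟩

theorem cycleIndex_apply (x : Fin n) : cycleIndex g (g x) = cycleIndex g x := by
  rcases h : cycleIndex g x with c | y
  · rw [cycleIndex_eq_inl] at h ⊢
    have := Equiv.Perm.mem_cycleFactorsFinset_iff.mp c.2
    rw [← this.2 x h]
    exact Equiv.Perm.apply_mem_support.mpr h
  · rw [cycleIndex_eq_inr] at h ⊢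
    rw [h, y.2]

theorem sameCycle_of_cycleIndex_eq {x y : Fin n} (h : cycleIndex g x = cycleIndex g y) :
    g.SameCycle x y := by
  rcases hy : cycleIndex g y with c | z
  · have hx := h.trans hy
    rw [cycleIndex_eq_inl] at hx hy
    rw [Equiv.Perm.cycle_is_cycleOf hx c.2] at hy
    exact (Equiv.Perm.mem_support_cycleOf_iff.mp hy).1
  · have hx := h.trans hy
    rw [cycleIndex_eq_inr] at hx hy
    rw [hx, hy]

theorem map_cycleLength : Finset.univ.val.map (cycleLength g) = g.partition.parts := by
  rw [Equiv.Perm.parts_partition, ← Finset.univ_disjSum_univ, Finset.val_disjSum,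
    Multiset.disjSum, Multiset.map_add, Multiset.map_map, Multiset.map_map]
  congr 1
  · rw [Equiv.Perm.cycleType_def, Finset.univ_eq_attach, Finset.attach_val]
    exact Multiset.attach_map_val' g.cycleFactorsFinset.val fun c => c.support.card
  · change Finset.univ.val.map (fun _ => 1) = _
    rw [Multiset.map_const', Finset.card_val, Finset.card_univ, Fintype.card_subtype,
      ← Finset.card_compl]
    congr 2
    ext x
    simp

theorem permChar_eq_assignCount {l s : ℕ} (mu : Fin l → ℕ)
    (hg : g.partition.parts = Finset.univ.val.map mu) (α : Fin s → ℤ) :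
    permChar α g = assignCount mu α := by
  obtain ⟨e, he⟩ := exists_equiv_of_map_univ_eq (hg.symm.trans (map_cycleLength g).symm)
  let κ : Fin n → Fin l := fun x => e (cycleIndex g x)
  have hκg : ∀ x, κ (g x) = κ x := fun x => congrArg e (cycleIndex_apply g x)
  have hκs : ∀ x y, κ x = κ y → g.SameCycle x y := fun x y h =>
    sameCycle_of_cycleIndex_eq g (e.injective h)
  have hκc : ∀ j, (Finset.univ.filter fun x => κ x = j).card = mu j := by
    intro j
    rw [← e.apply_symm_apply j, he, ← card_cycleIndex_fiber]
    congr 1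
    ext x
    simp [κ, Equiv.eq_symm_apply]
  have hpos : ∀ j, 0 < mu j := fun j => g.partition.parts_pos (by
    rw [hg]; exact Multiset.mem_map_of_mem _ (Finset.mem_univ_val j))
  have hsurj : Function.Surjective κ := by
    intro j
    have := hpos j
    rw [← hκc j, Finset.card_pos] at this
    obtain ⟨x, hx⟩ := this
    exact ⟨x, by simpa using hx⟩
  have hcount : ∀ (f : Fin l → Fin s) a,
      (Finset.univ.filter fun x => f (κ x) = a).card = ∑ j, if f j = a then mu j else 0 := by
    intro f a
    rw [Finset.card_eq_sum_card_fiberwise (f := κ) (t := Finset.univ) fun _ _ => by simp]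
    refine Finset.sum_congr rfl fun j _ => ?_
    rw [Finset.filter_filter]
    split_ifs with h
    · rw [← hκc j]
      congr 1
      ext x
      simp only [Finset.mem_filter, Finset.mem_univ, true_and, and_iff_right_iff_imp]
      rintro rfl
      exact h
    · rw [Finset.card_eq_zero, Finset.filter_eq_empty_iff]
      rintro x - ⟨h1, rfl⟩
      exact h h1
  rw [permChar, assignCount]
  congr 1
  symm
  refine Nat.card_eq_of_bijective
    (fun f : {f : Fin l → Fin s // ∀ a, ((∑ j, if f j = a then mu j else 0 : ℕ) : ℤ) = α a} =>
      (⟨⟨fun x => f.1 (κ x), fun a => by rw [hcount, f.2]⟩, ?_⟩ :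
        MulAction.fixedBy (Coloring n α) g)) ⟨?_, ?_⟩
  · refine Subtype.ext (funext fun x => ?_)
    change f.1 (κ (g⁻¹ x)) = f.1 (κ x)
    rw [← hκg (g⁻¹ x), show g (g⁻¹ x) = x from g.apply_symm_apply x]
  · intro f f' h
    refine Subtype.ext (funext fun j => ?_)
    obtain ⟨x, rfl⟩ := hsurj j
    exact congrFun (Subtype.ext_iff.mp (Subtype.ext_iff.mp h)) x
  · rintro ⟨u, hu⟩
    have hinv : ∀ x, u.1 (g x) = u.1 x := by
      intro x
      have := congrFun (Subtype.ext_iff.mp hu) (g x)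
      rw [Coloring.smul_apply, show g⁻¹ (g x) = x from g.symm_apply_apply x] at this
      exact this.symm
    have hcyc : ∀ x y, g.SameCycle x y → u.1 x = u.1 y := by
      intro x y h
      obtain ⟨i, -, hi⟩ := h.exists_pow_eq'
      rw [← hi]
      clear hi
      induction i with
      | zero => rfl
      | succ i ih => rw [pow_succ', Equiv.Perm.mul_apply, hinv, ih]
    choose r hr using hsurj
    have hru : ∀ x, u.1 (r (κ x)) = u.1 x := fun x => hcyc _ _ (hκs _ _ (hr _))
    refine ⟨⟨fun j => u.1 (r j), fun a => ?_⟩, Subtype.ext (Subtype.ext (funext hru))⟩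
    rw [← hcount, ← u.2 a]
    simp only [hru]

end Cycles

/-! ### Subrepresentations and regular representations -/

section Regular

variable {k : Type u} [Field k] {I : Type v} [Quiver.{w + 1} I]

namespace QRep

theorem cls_eq_iff {M N : QRep k I} : M.cls = N.cls ↔ M.Iso N := Quotient.eq

theorem Sub.ext_carrier {M : QRep k I} {U W : M.Sub} (h : ∀ i, U.carrier i = W.carrier i) :
    U = W := by
  cases U; cases W
  congr
  funext i
  exact h i

/-- The image of a subrepresentation under a morphism of representations. -/
def Sub.map {M N : QRep k I} (f : ∀ i, M.V i →ₗ[k] N.V i)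
    (hf : ∀ (i j : I) (h : i ⟶ j) (x : M.V i), f j (M.map h x) = N.map h (f i x)) (W : M.Sub) :
    N.Sub where
  carrier i := (W.carrier i).map (f i)
  map_mem i j h := by
    rintro _ ⟨x, hx, rfl⟩
    exact ⟨M.map h x, W.map_mem i j h x hx, hf i j h x⟩

/-- The preimage of a subrepresentation under a morphism of representations. -/
def Sub.comap {M N : QRep k I} (f : ∀ i, M.V i →ₗ[k] N.V i)
    (hf : ∀ (i j : I) (h : i ⟶ j) (x : M.V i), f j (M.map h x) = N.map h (f i x)) (W : N.Sub) :
    M.Sub where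
  carrier i := (W.carrier i).comap (f i)
  map_mem i j h x hx := by
    rw [Submodule.mem_comap, hf]
    exact W.map_mem i j h _ hx

/-- The intersection of two subrepresentations. -/
def Sub.inf {M : QRep k I} (U W : M.Sub) : M.Sub where
  carrier i := U.carrier i ⊓ W.carrier i
  map_mem i j h x hx := ⟨U.map_mem i j h x hx.1, W.map_mem i j h x hx.2⟩

/-- The sum of two subrepresentations. -/
def Sub.sup {M : QRep k I} (U W : M.Sub) : M.Sub where
  carrier i := U.carrier i ⊔ W.carrier i
  map_mem i j h := by
    change U.carrier i ⊔ W.carrier i ≤ (U.carrier j ⊔ W.carrier j).comap (M.map h)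
    exact sup_le (fun x hx => Submodule.mem_sup_left (U.map_mem i j h x hx))
      fun x hx => Submodule.mem_sup_right (W.map_mem i j h x hx)

theorem Sub.dimVec_sup_add_inf {M : QRep k I} (U W : M.Sub) :
    (U.sup W).toRep.dimVec + (U.inf W).toRep.dimVec = U.toRep.dimVec + W.toRep.dimVec :=
  funext fun i => Submodule.finrank_sup_add_finrank_inf_eq (U.carrier i) (W.carrier i)

theorem Sub.dimVec_map_of_injective {M N : QRep k I} (f : ∀ i, M.V i →ₗ[k] N.V i)
    (hf : ∀ (i j : I) (h : i ⟶ j) (x : M.V i), f j (M.map h x) = N.map h (f i x))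
    (hinj : ∀ i, Function.Injective (f i)) (W : M.Sub) :
    (W.map f hf).toRep.dimVec = W.toRep.dimVec :=
  funext fun i => ((W.carrier i).equivMapOfInjective (f i) (hinj i)).finrank_eq.symm

theorem finrank_comap_subtype {V : Type*} [AddCommGroup V] [Module k V] (U K : Submodule k V) :
    Module.finrank k (K.comap U.subtype) = Module.finrank k (U ⊓ K : Submodule k V) := by
  rw [← Submodule.map_comap_subtype]
  exact (Submodule.equivMapOfInjective _ U.injective_subtype _).finrank_eq

/-- Rank-nullity for the restriction of a morphism to a subrepresentation. -/
theorem Sub.dimVec_map_add_inf {M N : QRep k I} (f : ∀ i, M.V i →ₗ[k] N.V i)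
    (hf : ∀ (i j : I) (h : i ⟶ j) (x : M.V i), f j (M.map h x) = N.map h (f i x))
    (U K : M.Sub) (hK : ∀ i, K.carrier i = LinearMap.ker (f i)) :
    U.toRep.dimVec = (U.map f hf).toRep.dimVec + (U.inf K).toRep.dimVec := by
  funext i
  have h1 := ((f i).domRestrict (U.carrier i)).finrank_range_add_finrank_ker
  rw [LinearMap.range_domRestrict, LinearMap.ker_domRestrict, finrank_comap_subtype, ← hK] at h1
  exact h1.symm

theorem Sub.dimVec_eq_zero_iff {M : QRep k I} {W : M.Sub} :
    W.toRep.dimVec = 0 ↔ ∀ i, W.carrier i = ⊥ :=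
  funext_iff.trans (forall_congr' fun _ => Submodule.finrank_eq_zero)

theorem Sub.dimVec_eq_iff {M : QRep k I} {W : M.Sub} :
    W.toRep.dimVec = M.dimVec ↔ ∀ i, W.carrier i = ⊤ :=
  funext_iff.trans (forall_congr' fun _ => ⟨Submodule.eq_top_of_finrank_eq, fun h =>
    (congrArg (fun S : Submodule k _ => Module.finrank k S) h).trans (finrank_top k _)⟩)

/-- An isomorphism of representations induces a bijection between the subrepresentations that
preserves the isomorphism classes of the subrepresentations and of the quotients. -/
theorem Iso.exists_subEquiv {M N : QRep k I} (h : M.Iso N) :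
    ∃ e : M.Sub ≃ N.Sub, ∀ W : M.Sub, W.toRep.Iso (e W).toRep ∧ W.quot.Iso (e W).quot := by
  obtain ⟨f, hf⟩ := h
  have hf' : ∀ (i j : I) (h : i ⟶ j) (x : N.V i),
      (f j).symm (N.map h x) = M.map h ((f i).symm x) := by
    intro i j h x
    rw [LinearEquiv.symm_apply_eq, hf, LinearEquiv.apply_symm_apply]
  refine ⟨⟨Sub.map (fun i => (f i).toLinearMap) hf, Sub.map (fun i => (f i).symm.toLinearMap) hf',
    fun W => Sub.ext_carrier fun i => ?_, fun W => Sub.ext_carrier fun i => ?_⟩, fun W => ⟨?_, ?_⟩⟩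
  · ext x
    simp [Sub.map]
  · ext x
    simp [Sub.map]
  · refine ⟨fun i => (f i).submoduleMap (W.carrier i), fun i j h x => Subtype.ext (hf i j h x.1)⟩
  · refine ⟨fun i => Submodule.Quotient.equiv _ _ (f i) rfl, fun i j h x => ?_⟩
    obtain ⟨x, rfl⟩ := Submodule.Quotient.mk_surjective _ x
    exact congrArg (Submodule.Quotient.mk) (hf i j h x)

end QRep

variable [Fintype I] [∀ i j : I, Fintype (i ⟶ j)]

theorem eulerFormNat_add_right (x y z : I → ℕ) :
    eulerFormNat I x (y + z) = eulerFormNat I x y + eulerFormNat I x z := by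
  simp only [eulerFormNat, eulerForm, Pi.add_apply, Nat.cast_add, mul_add,
    Finset.sum_add_distrib]
  ring

theorem eulerFormNat_zero_right (x : I → ℕ) : eulerFormNat I x 0 = 0 := by
  simp [eulerFormNat, eulerForm]

theorem eulerFormNat_nsmul_nsmul (a b : ℕ) (x y : I → ℕ) :
    eulerFormNat I (a • x) (b • y) = a * b * eulerFormNat I x y := by
  simp only [eulerFormNat, eulerForm, Pi.smul_apply, smul_eq_mul, Nat.cast_mul, mul_sub,
    Finset.mul_sum]
  congr 1
  · exact Finset.sum_congr rfl fun i _ => by ring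
  · exact Finset.sum_congr rfl fun i _ => Finset.sum_congr rfl fun j _ =>
      Finset.sum_congr rfl fun h _ => by ring

namespace QRep

variable {δ : I → ℕ}

theorem defect_eq_of_dimVec_eq {M N : QRep k I} (h : M.dimVec = N.dimVec) :
    M.defect δ = N.defect δ := by
  rw [defect, defect, h]

theorem defect_eq_add {M N L : QRep k I} (h : M.dimVec = N.dimVec + L.dimVec) :
    M.defect δ = N.defect δ + L.defect δ := by
  rw [defect, defect, defect, h, eulerFormNat_add_right]

theorem IsRegular.of_iso {M N : QRep k I} (hM : M.IsRegular δ) (h : M.Iso N) : N.IsRegular δ := by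
  refine ⟨(defect_eq_of_dimVec_eq h.dimVec_eq).symm.trans hM.1, fun W => ?_⟩
  obtain ⟨e, he⟩ := h.exists_subEquiv
  have := (he (e.symm W)).1
  rw [Equiv.apply_symm_apply] at this
  rw [← defect_eq_of_dimVec_eq this.dimVec_eq]
  exact hM.2 _

/-- A subrepresentation of defect zero of a regular representation is regular. -/
theorem IsRegular.sub {M : QRep k I} (hM : M.IsRegular δ) {W : M.Sub}
    (hW : W.toRep.defect δ = 0) : W.toRep.IsRegular δ := by
  refine ⟨hW, fun U => ?_⟩
  have := hM.2 (U.map (N := M) (fun i => (W.carrier i).subtype) fun i j h x => rfl)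
  rwa [defect_eq_of_dimVec_eq (Sub.dimVec_map_of_injective (N := M) _ (fun _ _ _ _ => rfl)
    (fun i => Submodule.injective_subtype _) U)] at this

theorem IsRegular.defect_inf {M : QRep k I} (hM : M.IsRegular δ) {U W : M.Sub}
    (hU : U.toRep.defect δ = 0) (hW : W.toRep.defect δ = 0) : (U.inf W).toRep.defect δ = 0 := by
  have h1 := hM.2 (U.sup W)
  have h2 := hM.2 (U.inf W)
  have h3 := congrArg (eulerFormNat I δ) (U.dimVec_sup_add_inf W)
  rw [eulerFormNat_add_right, eulerFormNat_add_right] at h3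
  simp only [defect] at *
  lia

/-- Extensions of regular representations are regular. -/
theorem IsRegular.ext {M : QRep k I} (W : M.Sub) (hW : W.toRep.IsRegular δ)
    (hQ : W.quot.IsRegular δ) : M.IsRegular δ := by
  refine ⟨by rw [defect_eq_add W.dimVec_add, hW.1, hQ.1, add_zero], fun U => ?_⟩
  have hf : ∀ (i j : I) (h : i ⟶ j) (x : M.V i),
      (W.carrier j).mkQ (M.map h x) = W.quot.map h ((W.carrier i).mkQ x) := fun i j h x => rfl
  rw [defect_eq_add (Sub.dimVec_map_add_inf (N := W.quot) _ hf U W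
    fun i => (Submodule.ker_mkQ _).symm)]
  have h1 := hQ.2 (U.map _ hf)
  have h2 := hW.2 (U.comap (M := W.toRep) (fun i => (W.carrier i).subtype) fun i j h x => rfl)
  have h3 : (U.inf W).toRep.dimVec = (U.comap (M := W.toRep) (fun i => (W.carrier i).subtype)
      fun i j h x => rfl).toRep.dimVec := by
    funext i
    change Module.finrank k (U.carrier i ⊓ W.carrier i : Submodule k (M.V i))
      = Module.finrank k ((U.carrier i).comap (W.carrier i).subtype)
    rw [finrank_comap_subtype, inf_comm]
  rw [defect_eq_of_dimVec_eq h3]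
  lia

theorem isRegular_of_dimVec_eq_zero {M : QRep k I} (hM : M.dimVec = 0) : M.IsRegular δ := by
  have h0 : ∀ N : QRep k I, N.dimVec = 0 → N.defect δ = 0 := fun N hN => by
    rw [defect, hN, eulerFormNat_zero_right]
  refine ⟨h0 M hM, fun W => (h0 _ ?_).le⟩
  have := W.dimVec_add
  rw [hM] at this
  funext i
  have := congrFun this i
  simp only [Pi.zero_apply, Pi.add_apply] at this ⊢
  omega

theorem IsHomogeneousRegular.isRegular {M : QRep k I} (hM : M.IsHomogeneousRegular δ) :
    M.IsRegular δ := by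
  induction hM with
  | zero M hM => exact isRegular_of_dimVec_eq_zero hM
  | ext M W d _ hQ ih => exact ih.ext W hQ.1.1

theorem IsRegularSimple.of_iso {M N : QRep k I} (hM : M.IsRegularSimple δ) (h : M.Iso N) :
    N.IsRegularSimple δ := by
  refine ⟨hM.1.of_iso h, h.dimVec_eq ▸ hM.2.1, fun W hW => ?_⟩
  obtain ⟨e, he⟩ := h.exists_subEquiv
  have hi := (he (e.symm W)).1
  rw [Equiv.apply_symm_apply] at hi
  have := hM.2.2 (e.symm W) (hW.of_iso hi.symm)
  rwa [← Sub.dimVec_eq_zero_iff, ← Sub.dimVec_eq_iff, hi.dimVec_eq, h.dimVec_eq,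
    Sub.dimVec_eq_zero_iff, Sub.dimVec_eq_iff] at this

theorem IsHomogeneousRegularSimple.of_iso {M N : QRep k I} {d : ℕ}
    (hM : M.IsHomogeneousRegularSimple δ d) (h : M.Iso N) : N.IsHomogeneousRegularSimple δ d :=
  ⟨hM.1.of_iso h, h.dimVec_eq ▸ hM.2⟩

theorem IsHomogeneousRegular.of_iso {M N : QRep k I} (hM : M.IsHomogeneousRegular δ)
    (h : M.Iso N) : N.IsHomogeneousRegular δ := by
  induction hM generalizing N with
  | zero M hM => exact .zero N (h.dimVec_eq ▸ hM)
  | ext M W d _ hQ ih =>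
    obtain ⟨e, he⟩ := h.exists_subEquiv
    exact .ext N (e W) d (ih (he W).1) (hQ.of_iso (he W).2)

end QRep

end Regular

/-! ### Direct sums of regular simple representations -/

section DirectSum

variable {k : Type u} [Field k] {I : Type v} [Quiver.{w + 1} I]

namespace QRep

section Coordinate

variable {ι : Type} [Fintype ι] (E : ι → QRep k I)

theorem dimVec_directSum (i : I) : (directSum E).dimVec i = ∑ a, (E a).dimVec i :=
  Module.finrank_pi_fintype k

/-- The projection of a direct sum to a partial direct sum. -/
def projOn (p : ι → Prop) [Fintype {a // p a}] (i : I) :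
    (directSum E).V i →ₗ[k] (directSum fun a : {a // p a} => E a.1).V i :=
  LinearMap.pi fun a => LinearMap.proj a.1

/-- The partial direct sum `⨁_{a ∈ J} E_a` as a subrepresentation of `⨁_a E_a`. -/
def coordSub (J : Finset ι) : (directSum E).Sub where
  carrier i := {
    carrier := {x | ∀ a, a ∉ J → x a = 0}
    add_mem' := fun {x y} hx hy a ha => by
      change x a + y a = 0
      rw [hx a ha, hy a ha, add_zero]
    zero_mem' := fun a _ => rfl
    smul_mem' := fun c x hx a ha => by
      change c • x a = 0
      rw [hx a ha, smul_zero] }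
  map_mem i j h x hx a ha := by
    change (E a).map h (x a) = 0
    rw [hx a ha, map_zero]

theorem mem_coordSub {J : Finset ι} {i : I} {x : (directSum E).V i} :
    x ∈ (coordSub E J).carrier i ↔ ∀ a, a ∉ J → x a = 0 := Iff.rfl

open Classical in
theorem coordSub_toRep_iso (J : Finset ι) :
    (coordSub E J).toRep.Iso (directSum fun a : {a // a ∈ J} => E a.1) := by
  refine ⟨fun i => LinearEquiv.ofBijective
    ((projOn E (· ∈ J) i).domRestrict ((coordSub E J).carrier i)) ⟨?_, ?_⟩, fun i j h x => rfl⟩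
  · rintro ⟨x, hx⟩ ⟨y, hy⟩ hxy
    refine Subtype.ext (funext fun a => ?_)
    by_cases ha : a ∈ J
    · exact congrFun hxy ⟨a, ha⟩
    · exact (hx a ha).trans (hy a ha).symm
  · intro y
    refine ⟨⟨fun a => if ha : a ∈ J then y ⟨a, ha⟩ else 0, fun a ha => dif_neg ha⟩,
      funext fun a => ?_⟩
    exact dif_pos a.2

open Classical in
theorem coordSub_quot_iso (J : Finset ι) :
    (coordSub E J).quot.Iso (directSum fun a : {a // a ∉ J} => E a.1) := by
  have hker : ∀ i, (coordSub E J).carrier i = LinearMap.ker (projOn E (· ∉ J) i) := by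
    intro i
    ext x
    rw [mem_coordSub, LinearMap.mem_ker]
    exact ⟨fun h => funext fun a => h a.1 a.2, fun h a ha => congrFun h ⟨a, ha⟩⟩
  have hsurj : ∀ i, Function.Surjective (projOn E (· ∉ J) i) := by
    intro i y
    refine ⟨fun a => if ha : a ∉ J then y ⟨a, ha⟩ else 0, funext fun a => ?_⟩
    exact dif_pos a.2
  refine ⟨fun i => (Submodule.quotEquivOfEq _ _ (hker i)).trans
    ((projOn E (· ∉ J) i).quotKerEquivOfSurjective (hsurj i)), fun i j h x => ?_⟩
  obtain ⟨x, rfl⟩ := Submodule.Quotient.mk_surjective _ x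
  rfl

theorem iso_directSum_of_unique {κ : Type} [Fintype κ] [Unique κ] (F : κ → QRep k I) :
    (directSum F).Iso (F default) :=
  ⟨fun i => LinearEquiv.piUnique k fun a => (F a).V i, fun _ _ _ _ => rfl⟩

end Coordinate

theorem coordSub_injective {ι : Type} [Fintype ι] {E : ι → QRep k I}
    (hE : ∀ a, (E a).dimVec ≠ 0) : Function.Injective (coordSub E) := by
  classical
  have key : ∀ J J' : Finset ι, coordSub E J = coordSub E J' → J ⊆ J' := by
    intro J J' h a ha
    by_contra ha'
    refine hE a (funext fun i => ?_)
    rw [dimVec, Pi.zero_apply, Module.finrank_eq_zero_iff_of_free]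
    refine subsingleton_of_forall_eq 0 fun y => ?_
    have h1 : (Pi.single a y : ∀ a, (E a).V i) ∈ (coordSub E J).carrier i := fun c hc =>
      Pi.single_eq_of_ne (fun hca => hc (by rw [hca]; exact ha)) _
    rw [h] at h1
    have h2 := h1 a ha'
    rwa [Pi.single_eq_same] at h2
  exact fun J J' h => Finset.Subset.antisymm (key J J' h) (key J' J h.symm)

variable [Fintype I] [∀ i j : I, Fintype (i ⟶ j)] {δ : I → ℕ}

/-- A direct sum of homogeneous regular simple representations is homogeneous regular. -/
theorem isHomogeneousRegular_directSum {ι : Type} [Fintype ι] (E : ι → QRep k I) (μ : ι → ℕ)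
    (hE : ∀ a, (E a).IsHomogeneousRegularSimple δ (μ a)) :
    (directSum E).IsHomogeneousRegular δ := by
  classical
  induction hn : Fintype.card ι generalizing ι with
  | zero =>
    have := Fintype.card_eq_zero_iff.mp hn
    exact .zero _ (funext fun i => by rw [dimVec_directSum]; simp)
  | succ m ih =>
    have : Nonempty ι := Fintype.card_pos_iff.mp (by omega)
    obtain ⟨b⟩ := this
    have hcard : Fintype.card {a // a ∈ ({b}ᶜ : Finset ι)} = m := by
      rw [Fintype.card_coe, Finset.card_compl, Finset.card_singleton]
      omega
    have h1 := ih (fun a : {a // a ∈ ({b}ᶜ : Finset ι)} => E a.1) (fun a => μ a.1)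
      (fun a => hE a.1) hcard
    let : Unique {a // a ∉ ({b}ᶜ : Finset ι)} :=
      ⟨⟨⟨b, by simp⟩⟩, fun a => Subtype.ext (by simpa using a.2)⟩
    have h2 := iso_directSum_of_unique fun a : {a // a ∉ ({b}ᶜ : Finset ι)} => E a.1
    exact .ext _ (coordSub E {b}ᶜ) (μ b) (h1.of_iso (coordSub_toRep_iso E _).symm)
      ((hE b).of_iso (h2.symm.trans (coordSub_quot_iso E _).symm))

/-- The image of a subrepresentation of defect zero under the projection to a summand. -/
theorem image_eq_bot_or_top {ι : Type} [Fintype ι] [DecidableEq ι] {E : ι → QRep k I}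
    (hE : ∀ a, (E a).IsRegularSimple δ) (hreg : (directSum E).IsRegular δ)
    (hcoord : ∀ J, (coordSub E J).toRep.defect δ = 0) (U : (directSum E).Sub)
    (hU : U.toRep.defect δ = 0) (b : ι) :
    (∀ i, ∀ x ∈ U.carrier i, x b = 0) ∨ ∀ i (y : (E b).V i), ∃ x ∈ U.carrier i, x b = y := by
  let f : ∀ i, (directSum E).V i →ₗ[k] (E b).V i := fun i => LinearMap.proj b
  have hf : ∀ (i j : I) (h : i ⟶ j) (x : (directSum E).V i),
      f j ((directSum E).map h x) = (E b).map h (f i x) := fun _ _ _ _ => rfl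
  have hker : ∀ i, (coordSub E {b}ᶜ).carrier i = LinearMap.ker (f i) := by
    intro i
    ext x
    refine ⟨fun h => h b (by simp), fun h a ha => ?_⟩
    obtain rfl : a = b := by simpa using ha
    exact h
  have h1 := defect_eq_add (δ := δ) (Sub.dimVec_map_add_inf f hf U _ hker)
  rw [hU, hreg.defect_inf hU (hcoord _), add_zero] at h1
  rcases (hE b).2.2 (U.map f hf) ((hE b).1.sub h1.symm) with h | h
  · left
    intro i x hx
    have : f i x ∈ (U.map f hf).carrier i := ⟨x, hx, rfl⟩
    rw [h i, Submodule.mem_bot] at this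
    exact this
  · right
    intro i y
    have : y ∈ (U.map f hf).carrier i := by rw [h i]; trivial
    exact this

/-- A nonzero subrepresentation of defect zero of a direct sum of pairwise nonisomorphic regular
simple representations contains one of the summands. -/
theorem exists_coordSub_le {ι : Type} [Fintype ι] [DecidableEq ι] {E : ι → QRep k I}
    (hE : ∀ a, (E a).IsRegularSimple δ) (hreg : (directSum E).IsRegular δ)
    (hcoord : ∀ J, (coordSub E J).toRep.defect δ = 0)
    (hdist : ∀ a b, a ≠ b → ¬ (E a).Iso (E b)) (W : (directSum E).Sub)
    (hW : W.toRep.defect δ = 0) (hW0 : ∃ i, W.carrier i ≠ ⊥) :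
    ∃ b, ∀ i, (coordSub E {b}).carrier i ≤ W.carrier i := by
  -- A nonzero subrepresentation `U ≤ W` of defect zero and of least possible dimension.
  let P : ℕ → Prop := fun d => ∃ U : (directSum E).Sub, (∀ i, U.carrier i ≤ W.carrier i) ∧
    U.toRep.defect δ = 0 ∧ (∃ i, U.carrier i ≠ ⊥) ∧ ∑ i, U.toRep.dimVec i = d
  have hP : ∃ d, P d := ⟨_, W, fun _ => le_rfl, hW, hW0, rfl⟩
  classical
  obtain ⟨U, hUW, hU, ⟨i₀, hi₀⟩, hUd⟩ := Nat.find_spec hP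
  have hmin : ∀ K : (directSum E).Sub, K.toRep.defect δ = 0 →
      (∀ i, (U.inf K).carrier i = ⊥) ∨ ∀ i, U.carrier i ≤ K.carrier i := by
    intro K hK
    by_contra! hcon
    obtain ⟨hne, i₁, hi₁⟩ := hcon
    have hlt : ∑ i, (U.inf K).toRep.dimVec i < ∑ i, U.toRep.dimVec i :=
      Finset.sum_lt_sum (fun i _ => Submodule.finrank_mono (inf_le_left : U.carrier i ⊓ _ ≤ _))
        ⟨i₁, Finset.mem_univ _, Submodule.finrank_lt_finrank_of_lt
          (lt_of_le_of_ne (inf_le_left : U.carrier i₁ ⊓ _ ≤ _) fun h => hi₁ (inf_eq_left.mp h))⟩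
    rw [hUd] at hlt
    exact Nat.find_min hP hlt
      ⟨U.inf K, fun i => inf_le_left.trans (hUW i), hreg.defect_inf hU hK, hne, rfl⟩
  -- If the projection of `U` to a summand is nonzero, then it is an isomorphism.
  have hiso : ∀ b, (∃ i, ∃ x ∈ U.carrier i, x b ≠ 0) → U.toRep.Iso (E b) := by
    rintro b ⟨i₁, x₁, hx₁, hne⟩
    have hsurj := (image_eq_bot_or_top hE hreg hcoord U hU b).resolve_left
      fun h => hne (h i₁ x₁ hx₁)
    have hinj := (hmin _ (hcoord {b}ᶜ)).resolve_right
      fun h => hne (h i₁ hx₁ b (by simp))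
    let f : ∀ i, (directSum E).V i →ₗ[k] (E b).V i := fun i => LinearMap.proj b
    refine ⟨fun i => LinearEquiv.ofBijective ((f i).domRestrict (U.carrier i)) ⟨?_, ?_⟩,
      fun i j h x => rfl⟩
    · rw [← LinearMap.ker_eq_bot, LinearMap.ker_eq_bot']
      rintro ⟨x, hx⟩ hxb
      have : x ∈ (U.inf (coordSub E {b}ᶜ)).carrier i := by
        refine ⟨hx, fun a ha => ?_⟩
        have : a = b := by simpa using ha
        rw [this]
        exact hxb
      rw [hinj i, Submodule.mem_bot] at this
      exact Subtype.ext this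
    · intro y
      obtain ⟨x, hx, hxy⟩ := hsurj i y
      exact ⟨⟨x, hx⟩, hxy⟩
  obtain ⟨x₀, hx₀, hne₀⟩ := (Submodule.ne_bot_iff _).mp hi₀
  obtain ⟨b, hb⟩ := Function.ne_iff.mp hne₀
  refine ⟨b, fun i y hy => hUW i ?_⟩
  have hsurj := (image_eq_bot_or_top hE hreg hcoord U hU b).resolve_left
    fun h => hb (h i₀ x₀ hx₀)
  obtain ⟨x, hx, hxy⟩ := hsurj i (y b)
  have : x = y := by
    funext a
    by_cases hab : a = b
    · rw [hab, hxy]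
    · rw [hy a (by simpa using hab)]
      by_contra hxa
      exact hdist a b hab ((hiso a ⟨i, x, hx, hxa⟩).symm.trans (hiso b ⟨i₀, x₀, hx₀, hb⟩))
  rwa [← this]

/-- The regular subrepresentations of a direct sum of pairwise nonisomorphic regular simple
representations are the partial direct sums. -/
theorem exists_eq_coordSub {ι : Type} [Fintype ι] {E : ι → QRep k I}
    (hE : ∀ a, (E a).IsRegularSimple δ) (hreg : (directSum E).IsRegular δ)
    (hdist : ∀ a b, a ≠ b → ¬ (E a).Iso (E b)) (W : (directSum E).Sub)
    (hW : W.toRep.IsRegular δ) : ∃ J, W = coordSub E J := by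
  classical
  have hcoord : ∀ J, (coordSub E J).toRep.defect δ = 0 := by
    intro J
    have : (coordSub E J).toRep.dimVec = fun i => ∑ a : {a // a ∈ J}, (E a.1).dimVec i := by
      rw [(coordSub_toRep_iso E J).dimVec_eq]
      funext i
      exact dimVec_directSum _ i
    have h2 : (fun i => ∑ a : {a // a ∈ J}, (E a.1).dimVec i)
        = ∑ a : {a // a ∈ J}, (E a.1).dimVec := by
      funext i
      rw [Finset.sum_apply]
    rw [defect, this, h2]
    have h3 : ∀ S : Finset {a // a ∈ J}, eulerFormNat I δ (∑ a ∈ S, (E a.1).dimVec) = 0 := by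
      intro S
      induction S using Finset.induction_on with
      | empty => rw [Finset.sum_empty, eulerFormNat_zero_right]
      | insert a S ha ih =>
        rw [Finset.sum_insert ha, eulerFormNat_add_right, ih, add_zero]
        exact (hE a.1).1.1
    exact h3 Finset.univ
  let J : Finset ι := Finset.univ.filter fun b => ∀ i, (coordSub E {b}).carrier i ≤ W.carrier i
  have hJ : ∀ b, b ∈ J ↔ ∀ i, (coordSub E {b}).carrier i ≤ W.carrier i := fun b => by simp [J]
  have hJW : ∀ i (x : (directSum E).V i), (∀ a, a ∉ J → x a = 0) → x ∈ W.carrier i := by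
    intro i x hx
    have h1 : x = ∑ a, (Pi.single a (x a) : ∀ a, (E a).V i) := (Finset.univ_sum_single x).symm
    rw [h1]
    refine Submodule.sum_mem _ fun a _ => ?_
    by_cases ha : a ∈ J
    · refine (hJ a).mp ha i fun c hc => ?_
      exact Pi.single_eq_of_ne (by simpa using hc) _
    · rw [hx a ha, Pi.single_zero]
      exact Submodule.zero_mem _
  have hzero : ∀ i, (W.inf (coordSub E Jᶜ)).carrier i = ⊥ := by
    by_contra! hcon
    obtain ⟨b, hb⟩ := exists_coordSub_le hE hreg hcoord hdist _
      (hreg.defect_inf hW.1 (hcoord Jᶜ)) hcon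
    have hbJ : b ∈ J := (hJ b).mpr fun i => (hb i).trans inf_le_left
    refine (hE b).2.1 (funext fun i => ?_)
    rw [dimVec, Pi.zero_apply, Module.finrank_eq_zero_iff_of_free]
    refine subsingleton_of_forall_eq 0 fun y => ?_
    have h1 : (Pi.single b y : ∀ a, (E a).V i) ∈ (coordSub E {b}).carrier i := fun c hc =>
      Pi.single_eq_of_ne (by simpa using hc) _
    have h2 := (hb i h1).2 b (by simpa using hbJ)
    rwa [Pi.single_eq_same] at h2
  refine ⟨J, Sub.ext_carrier fun i => le_antisymm (fun x hx a ha => ?_) fun x hx => hJW i x hx⟩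
  let y : (directSum E).V i := fun a => if a ∈ J then x a else 0
  have hy : y ∈ W.carrier i := hJW i y fun a ha => if_neg ha
  have hxy : x - y ∈ (W.inf (coordSub E Jᶜ)).carrier i := by
    refine ⟨Submodule.sub_mem _ hx hy, fun c hc => ?_⟩
    have hc' : c ∈ J := by simpa using hc
    change x c - y c = 0
    simp [y, hc']
  rw [hzero i, Submodule.mem_bot, sub_eq_zero] at hxy
  rw [hxy]
  exact if_neg ha

end QRep

end DirectSum

/-! ### Coefficients of products in the Ringel-Hall algebra -/

section HallCoefficients

theorem sum_eq_sum_mem_add_sum_notMem {ι : Type} [Fintype ι] [DecidableEq ι] (J : Finset ι)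
    (F : ι → ℕ) : ∑ a, F a = ∑ a : {a // a ∈ J}, F a.1 + ∑ a : {a // a ∉ J}, F a.1 := by
  convert (Fintype.sum_subtype_add_sum_subtype (· ∈ J) F).symm

/-- Recursion for the number of weighted assignments, on the set of points that are not mapped to
the first index. -/
theorem assignCount_succ {ι : Type} [Fintype ι] [DecidableEq ι] {s : ℕ} (μ : ι → ℕ)
    (α : Fin (s + 1) → ℤ) :
    assignCount μ α = ∑ J : Finset ι,
      if ((∑ a : {a // a ∉ J}, μ a.1 : ℕ) : ℤ) = α 0
      then assignCount (fun a : {a // a ∈ J} => μ a.1) fun b => α b.succ else 0 := by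
  classical
  rw [assignCount, Nat.card_eq_fintype_card, Fintype.card_subtype,
    Finset.card_eq_sum_card_fiberwise (f := fun f : ι → Fin (s + 1) =>
      Finset.univ.filter fun a => f a ≠ 0) (t := Finset.univ) fun _ _ => by simp]
  refine Finset.sum_congr rfl fun J _ => ?_
  rw [Finset.filter_filter]
  let ext0 : ({a // a ∈ J} → Fin s) → ι → Fin (s + 1) := fun h a =>
    if ha : a ∈ J then (h ⟨a, ha⟩).succ else 0
  have hmem : ∀ h a (ha : a ∈ J), ext0 h a = (h ⟨a, ha⟩).succ := fun h a ha => dif_pos ha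
  have hnot : ∀ h a, a ∉ J → ext0 h a = 0 := fun h a ha => dif_neg ha
  have hfilter : ∀ h, (Finset.univ.filter fun a => ext0 h a ≠ 0) = J := by
    intro h
    ext a
    by_cases ha : a ∈ J
    · simp [hmem h a ha, ha]
    · simp [hnot h a ha, ha]
  have h0 : ∀ h, ∑ a, (if ext0 h a = 0 then μ a else 0) = ∑ a : {a // a ∉ J}, μ a.1 := by
    intro h
    rw [sum_eq_sum_mem_add_sum_notMem J, Finset.sum_eq_zero, zero_add]
    · exact Finset.sum_congr rfl fun a _ => if_pos (hnot h a.1 a.2)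
    · intro a _
      rw [hmem h a.1 a.2]
      exact if_neg (Fin.succ_ne_zero _)
  have hs : ∀ h (b : Fin s), ∑ a, (if ext0 h a = b.succ then μ a else 0)
      = ∑ a : {a // a ∈ J}, if h a = b then μ a.1 else 0 := by
    intro h b
    rw [sum_eq_sum_mem_add_sum_notMem J, add_eq_left.mpr]
    · refine Finset.sum_congr rfl fun a _ => ?_
      rw [hmem h a.1 a.2]
      exact if_congr Fin.succ_inj rfl rfl
    · refine Finset.sum_eq_zero fun a _ => ?_
      rw [hnot h a.1 a.2]
      exact if_neg (Fin.succ_ne_zero _).symm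
  have hsurj : ∀ f : ι → Fin (s + 1), (Finset.univ.filter fun a => f a ≠ 0) = J →
      ∃ h, ext0 h = f := by
    intro f hf
    have hfJ : ∀ a, a ∈ J ↔ f a ≠ 0 := fun a => by rw [← hf]; simp
    let h : {a // a ∈ J} → Fin s := fun a => (f a.1).pred ((hfJ a.1).mp a.2)
    refine ⟨h, funext fun a => ?_⟩
    by_cases ha : a ∈ J
    · exact (hmem h a ha).trans (Fin.succ_pred _ _)
    · refine (hnot h a ha).trans ?_
      exact (not_not.mp fun hne => ha ((hfJ a).mpr hne)).symm
  split_ifs with hJ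
  · rw [assignCount, Nat.card_eq_fintype_card, Fintype.card_subtype]
    symm
    refine Finset.card_bij (fun h _ => ext0 h) (fun h hh => ?_)
      (fun h _ h' _ heq => ?_) fun f hf => ?_
    · simp only [Finset.mem_filter, Finset.mem_univ, true_and] at hh ⊢
      refine ⟨fun a => ?_, hfilter h⟩
      induction a using Fin.cases with
      | zero => rw [h0, hJ]
      | succ b => rw [hs, hh b]
    · funext a
      have := congrFun heq a.1
      rw [hmem h a.1 a.2, hmem h' a.1 a.2] at this
      exact Fin.succ_injective _ this
    · simp only [Finset.mem_filter, Finset.mem_univ, true_and] at hf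
      obtain ⟨h, rfl⟩ := hsurj f hf.2
      refine ⟨h, ?_, rfl⟩
      simp only [Finset.mem_filter, Finset.mem_univ, true_and]
      intro b
      rw [← hs, hf.1]
  · rw [Finset.card_eq_zero, Finset.filter_eq_empty_iff]
    rintro f - ⟨h1, h2⟩
    obtain ⟨h, rfl⟩ := hsurj f h2
    exact hJ (by rw [← h0 h, h1])

variable {k : Type u} [Field k] [Fintype k] {I : Type v} [Fintype I] [Quiver.{w + 1} I]
  [∀ i j : I, Fintype (i ⟶ j)]

omit [∀ i j : I, Fintype (i ⟶ j)] in
theorem finite_sub (M : QRep k I) : Finite M.Sub := by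
  have : ∀ i, Finite (M.V i) := fun i => Module.finite_of_finite k
  have : ∀ i, Finite (Submodule k (M.V i)) := fun i =>
    Finite.of_injective (fun U => (U : Set (M.V i))) SetLike.coe_injective
  exact Finite.of_injective QRep.Sub.carrier fun U W h =>
    QRep.Sub.ext_carrier fun i => congrFun h i

instance (M : QRep k I) : Fintype M.Sub :=
  have := finite_sub M
  Fintype.ofFinite _

omit [∀ i j : I, Fintype (i ⟶ j)] in
open Classical in
theorem hallNumber_cls (M : QRep k I) (m n : IsoClass k I) :
    hallNumber M.cls m n
      = ∑ W : M.Sub, if W.toRep.cls = n ∧ W.quot.cls = m then 1 else 0 := by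
  have h : QRep.Iso M.cls.out M := QRep.cls_eq_iff.mp (Quotient.out_eq M.cls)
  obtain ⟨e, he⟩ := h.exists_subEquiv
  rw [Finset.sum_boole, hallNumber, Nat.cast_id, ← Fintype.card_subtype,
    ← Nat.card_eq_fintype_card]
  refine Nat.card_congr (e.subtypeEquiv fun W => ?_)
  rw [QRep.cls_eq_iff.mpr (he W).1, QRep.cls_eq_iff.mpr (he W).2]

/-- The coefficients of a product, as a sum over all subrepresentations. -/
theorem hallMul_apply (x y : HallAlg k I) (M : QRep k I) :
    hallMul x y M.cls = ∑ W : M.Sub, vq k ^ eulerFormNat I W.quot.dimVec W.toRep.dimVec *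
      (x W.quot.cls * y W.toRep.cls) := by
  classical
  have hbasis : ∀ m n : IsoClass k I, hallMulBasis m n M.cls
      = ∑ W : M.Sub, if W.toRep.cls = n ∧ W.quot.cls = m
          then vq k ^ eulerFormNat I m.dimVec n.dimVec else 0 := by
    intro m n
    change vq k ^ eulerFormNat I m.dimVec n.dimVec * (hallNumber M.cls m n : HallField k) = _
    rw [hallNumber_cls, Nat.cast_sum, Finset.mul_sum]
    refine Finset.sum_congr rfl fun W _ => ?_
    split_ifs <;> simp
  rw [hallMul, Finsupp.sum_apply, Finsupp.sum]
  simp_rw [Finsupp.sum_apply, Finsupp.sum, Finsupp.smul_apply, hbasis, smul_eq_mul, Finset.mul_sum]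
  have hswap : ∀ m ∈ x.support, (∑ n ∈ y.support, ∑ W : M.Sub, x m * y n *
      (if W.toRep.cls = n ∧ W.quot.cls = m
        then vq k ^ eulerFormNat I m.dimVec n.dimVec else 0))
      = ∑ W : M.Sub, ∑ n ∈ y.support, x m * y n *
      (if W.toRep.cls = n ∧ W.quot.cls = m
        then vq k ^ eulerFormNat I m.dimVec n.dimVec else 0) := fun m _ => Finset.sum_comm
  rw [Finset.sum_congr rfl hswap, Finset.sum_comm]
  refine Finset.sum_congr rfl fun W _ => ?_
  rw [Finset.sum_eq_single W.quot.cls, Finset.sum_eq_single W.toRep.cls]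
  · rw [if_pos ⟨rfl, rfl⟩, mul_comm]
    rfl
  · intro n _ hn
    rw [if_neg fun h => hn h.1.symm, mul_zero]
  · intro h
    rw [Finsupp.notMem_support_iff.mp h]
    ring
  · intro m _ hm
    refine Finset.sum_eq_zero fun n _ => ?_
    rw [if_neg fun h => hm h.2.symm, mul_zero]
  · intro h
    rw [Finsupp.notMem_support_iff.mp h]
    simp

theorem vq_ne_zero : vq k ≠ 0 := by
  intro h
  have h1 := congrArg Subtype.val h
  change ((Real.sqrt (Fintype.card k) : ℝ) : ℂ) = 0 at h1
  rw [Complex.ofReal_eq_zero, Real.sqrt_eq_zero (Nat.cast_nonneg _), Nat.cast_eq_zero] at h1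
  exact Fintype.card_ne_zero h1

variable {δ : I → ℕ}

/-- The representation `M` is regular and its dimension vector is a multiple of `δ`. -/
def IsRegularMultiple (δ : I → ℕ) (M : QRep k I) : Prop :=
  M.IsRegular δ ∧ ∃ a : ℕ, M.dimVec = a • δ

theorem isRegularMultiple_of_hallHInt_ne_zero {m : ℤ} {M : QRep k I}
    (h : hallHInt k δ m M.cls ≠ 0) : IsRegularMultiple δ M := by
  classical
  unfold hallHInt at h
  split_ifs at h with hm
  · change (if M.cls.dimVec = m.toNat • δ ∧ ∃ N : QRep k I, N.cls = M.cls ∧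
      N.IsHomogeneousRegular δ then vq k ^ (-((∑ i, M.cls.dimVec i : ℕ) : ℤ)) else 0) ≠ 0 at h
    split_ifs at h with h'
    · obtain ⟨h1, N, hN, hN'⟩ := h'
      exact ⟨hN'.isRegular.of_iso (QRep.cls_eq_iff.mp hN), _, h1⟩
    · exact absurd rfl h
  · exact absurd rfl h

theorem isRegularMultiple_of_hallProd_ne_zero (L : List ℤ) {M : QRep k I}
    (h : hallProd (L.map (hallHInt k δ)) M.cls ≠ 0) : IsRegularMultiple δ M := by
  induction L generalizing M with
  | nil =>
    have h1 : QRep.cls { V := fun _ => PUnit, map := fun _ => 0 } = M.cls := by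
      by_contra hne
      exact h (Finsupp.single_eq_of_ne' hne)
    have h2 := (QRep.cls_eq_iff.mp h1).dimVec_eq
    have h3 : M.dimVec = 0 := by
      rw [← h2]
      funext i
      exact Module.finrank_zero_of_subsingleton
    exact ⟨QRep.isRegular_of_dimVec_eq_zero h3, 0, by rw [h3, zero_smul]⟩
  | cons m L ih =>
    rw [List.map_cons, hallProd, List.foldr_cons, ← hallProd, hallMul_apply] at h
    obtain ⟨W, -, hW⟩ := Finset.exists_ne_zero_of_sum_ne_zero h
    obtain ⟨h1, a, ha⟩ := isRegularMultiple_of_hallHInt_ne_zero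
      (left_ne_zero_of_mul (right_ne_zero_of_mul hW))
    obtain ⟨h2, b, hb⟩ := ih (right_ne_zero_of_mul (right_ne_zero_of_mul hW))
    exact ⟨h2.ext W h1, a + b, by rw [W.dimVec_add, ha, hb, add_smul]⟩

omit [Fintype k] in
theorem dimVec_directSum_eq_smul {ι : Type} [Fintype ι] {E : ι → QRep k I} {μ : ι → ℕ}
    (hE : ∀ a, (E a).IsHomogeneousRegularSimple δ (μ a)) :
    (QRep.directSum E).dimVec = (∑ a, μ a) • δ := by
  funext i
  rw [QRep.dimVec_directSum, Pi.smul_apply, smul_eq_mul, Finset.sum_mul]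
  exact Finset.sum_congr rfl fun a _ => by rw [(hE a).2]; rfl

theorem hallHInt_directSum (hδ : δ ≠ 0) {ι : Type} [Fintype ι] {E : ι → QRep k I} {μ : ι → ℕ}
    (hE : ∀ a, (E a).IsHomogeneousRegularSimple δ (μ a)) (m : ℤ) :
    hallHInt k δ m (QRep.directSum E).cls = if ((∑ a, μ a : ℕ) : ℤ) = m
      then vq k ^ (-(((∑ a, μ a) * ∑ i, δ i : ℕ) : ℤ)) else 0 := by
  classical
  have hdim := dimVec_directSum_eq_smul hE
  unfold hallHInt
  by_cases hm : 0 ≤ m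
  · rw [if_pos hm]
    change (if (QRep.directSum E).dimVec = m.toNat • δ ∧
      ∃ N : QRep k I, N.cls = (QRep.directSum E).cls ∧ N.IsHomogeneousRegular δ
      then vq k ^ (-((∑ i, (QRep.directSum E).dimVec i : ℕ) : ℤ)) else 0) = _
    have hiff : ((QRep.directSum E).dimVec = m.toNat • δ ∧
        ∃ N : QRep k I, N.cls = (QRep.directSum E).cls ∧ N.IsHomogeneousRegular δ)
        ↔ ((∑ a, μ a : ℕ) : ℤ) = m := by
      rw [hdim]
      constructor
      · rintro ⟨h, -⟩
        obtain ⟨i, hi⟩ := Function.ne_iff.mp hδ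
        have := Nat.eq_of_mul_eq_mul_right (Nat.pos_of_ne_zero hi) (congrFun h i)
        rw [this, Int.toNat_of_nonneg hm]
      · intro h
        exact ⟨by rw [← h, Int.toNat_natCast], _, rfl,
          QRep.isHomogeneousRegular_directSum E μ hE⟩
    rw [if_congr hiff rfl rfl, hdim]
    simp only [Pi.smul_apply, smul_eq_mul, ← Finset.mul_sum]
  · rw [if_neg hm, if_neg (by lia)]
    rfl

/-- The coefficient of `⨁ E_a` in `H_{α_1} * ⋯ * H_{α_s}`: the relevant flags of
subrepresentations consist of partial direct sums, so they correspond to the maps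
`ι → {1, ..., s}` with the right total weights. -/
theorem hallProd_directSum (hδ : IsMinimalImaginaryRoot I δ) {s : ℕ} (α : Fin s → ℤ)
    {ι : Type} [Fintype ι] {E : ι → QRep k I} {μ : ι → ℕ}
    (hE : ∀ a, (E a).IsHomogeneousRegularSimple δ (μ a))
    (hdist : ∀ a b, a ≠ b → ¬ (E a).Iso (E b)) :
    hallProd (List.ofFn fun a => hallHInt k δ (α a)) (QRep.directSum E).cls
      = vq k ^ (-(((∑ a, μ a) * ∑ i, δ i : ℕ) : ℤ)) * (assignCount μ α : HallField k) := by
  classical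
  induction s generalizing ι with
  | zero =>
    rw [List.ofFn_zero, hallProd, List.foldr_nil, hallOne]
    rcases isEmpty_or_nonempty ι with hι | ⟨⟨b⟩⟩
    · have h1 : QRep.cls { V := fun _ => PUnit, map := fun _ => 0 } = (QRep.directSum E).cls := by
        refine QRep.cls_eq_iff.mpr ⟨fun i => ?_,
          fun i j h x => Subsingleton.elim (α := ∀ a, (E a).V j) _ _⟩
        have : Subsingleton ((QRep.directSum E).V i) :=
          inferInstanceAs (Subsingleton (∀ a, (E a).V i))
        exact { toFun := fun _ => 0, map_add' := by simp, map_smul' := by simp,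
                invFun := fun _ => PUnit.unit, left_inv := fun _ => rfl,
                right_inv := fun _ => Subsingleton.elim _ _ }
      have h2 : assignCount μ α = 1 := by
        rw [assignCount, Nat.card_eq_one_iff_unique]
        exact ⟨inferInstance, ⟨⟨fun a => isEmptyElim a, fun a => a.elim0⟩⟩⟩
      rw [h1, Finsupp.single_eq_same, h2]
      simp
    · have h1 : QRep.cls { V := fun _ => PUnit, map := fun _ => 0 }
          ≠ (QRep.directSum E).cls := by
        intro h
        have h2 := (QRep.cls_eq_iff.mp h).dimVec_eq
        refine (hE b).1.2.1 (funext fun i => ?_)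
        have h3 := congrFun h2 i
        rw [QRep.dimVec_directSum] at h3
        have h4 : ∑ a, (E a).dimVec i = 0 := h3.symm.trans Module.finrank_zero_of_subsingleton
        exact Finset.sum_eq_zero_iff.mp h4 b (Finset.mem_univ b)
      have h2 : assignCount μ α = 0 := by
        rw [assignCount, Nat.card_eq_zero]
        exact Or.inl ⟨fun f => (f.1 b).elim0⟩
      rw [Finsupp.single_eq_of_ne' h1, h2]
      simp
  | succ s ih =>
    have hreg := (QRep.isHomogeneousRegular_directSum E μ hE).isRegular
    have hL : List.ofFn (fun a : Fin s => hallHInt k δ (α a.succ))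
        = (List.ofFn fun a : Fin s => α a.succ).map (hallHInt k δ) := by
      rw [List.map_ofFn]; rfl
    rw [List.ofFn_succ, hallProd, List.foldr_cons, ← hallProd, hallMul_apply, assignCount_succ,
      Nat.cast_sum, Finset.mul_sum]
    symm
    refine Fintype.sum_of_injective (QRep.coordSub E)
      (QRep.coordSub_injective fun a => (hE a).1.2.1) _ _ (fun W hW => ?_) fun J => ?_
    · -- A subrepresentation that contributes is regular, hence a partial direct sum.
      by_contra hne
      rw [hL] at hne
      have h1 := isRegularMultiple_of_hallProd_ne_zero _
        (right_ne_zero_of_mul (right_ne_zero_of_mul hne))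
      obtain ⟨J, rfl⟩ := QRep.exists_eq_coordSub (fun a => (hE a).1) hreg hdist W h1.1
      exact hW ⟨J, rfl⟩
    · have hE1 : ∀ a : {a // a ∈ J}, (E a.1).IsHomogeneousRegularSimple δ (μ a.1) :=
        fun a => hE a.1
      have hE2 : ∀ a : {a // a ∉ J}, (E a.1).IsHomogeneousRegularSimple δ (μ a.1) :=
        fun a => hE a.1
      have hi1 := QRep.coordSub_toRep_iso E J
      have hi2 := QRep.coordSub_quot_iso E J
      have hsum : ∑ a, μ a = ∑ a : {a // a ∉ J}, μ a.1 + ∑ a : {a // a ∈ J}, μ a.1 := by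
        rw [add_comm]
        exact sum_eq_sum_mem_add_sum_notMem J μ
      rw [hi1.dimVec_eq, hi2.dimVec_eq, dimVec_directSum_eq_smul hE1, dimVec_directSum_eq_smul hE2,
        eulerFormNat_nsmul_nsmul, hδ.1.2, mul_zero, zpow_zero, one_mul,
        QRep.cls_eq_iff.mpr hi1, QRep.cls_eq_iff.mpr hi2, hallHInt_directSum hδ.1.1 hE2,
        ih (fun a => α a.succ) hE1 fun a b hab => hdist a.1 b.1 fun h => hab (Subtype.ext h)]
      split_ifs with h
      · rw [← mul_assoc, ← zpow_add₀ vq_ne_zero, hsum]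
        congr 2
        push_cast
        ring
      · simp

end HallCoefficients

end AffineHall

end

theorem mainTheorem8
    {k : Type u} [Field k] [Fintype k]
    {I : Type v} [Fintype I] [Quiver.{w + 1} I] [∀ i j : I, Fintype (i ⟶ j)]
    (hQ : AffineHall.IsAcyclicAffine I)
    (δ : I → ℕ) (hδ : AffineHall.IsMinimalImaginaryRoot I δ)
    (n : ℕ)
    {s : ℕ} (lam : Fin s → ℕ) (hlam : Antitone lam) (hlamn : ∑ a, lam a = n)
    {l : ℕ} (mu : Fin l → ℕ) (hmu : Antitone mu) (hmun : ∑ j, mu j = n)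
    (E : Fin l → AffineHall.QRep k I)
    (hE : ∀ j, (E j).IsHomogeneousRegularSimple δ (mu j))
    (hdistinct : ∀ i j, i ≠ j → ¬ (E i).Iso (E j))
    (g : Equiv.Perm (Fin n)) (hg : g.partition.parts = Finset.univ.val.map mu) :
    ((AffineHall.hallHPart k δ lam (AffineHall.QRep.directSum E).cls : AffineHall.HallField k) : ℂ)
        = ((Real.sqrt (Fintype.card k) : ℝ) : ℂ) ^ (-((n * ∑ i, δ i : ℕ) : ℤ))
          * (AffineHall.permModule n lam).character g
    ∧ ((AffineHall.hallSPart k δ lam (AffineHall.QRep.directSum E).cls :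
          AffineHall.HallField k) : ℂ)
        = ((Real.sqrt (Fintype.card k) : ℝ) : ℂ) ^ (-((n * ∑ i, δ i : ℕ) : ℤ))
          * (AffineHall.spechtModule n lam).toRepresentation.character g := by
  have hcoeff : ∀ α : Fin s → ℤ,
      ((AffineHall.hallProd (List.ofFn fun a => AffineHall.hallHInt k δ (α a))
        (AffineHall.QRep.directSum E).cls : AffineHall.HallField k) : ℂ)
      = ((Real.sqrt (Fintype.card k) : ℝ) : ℂ) ^ (-((n * ∑ i, δ i : ℕ) : ℤ))
        * (AffineHall.permChar α g : ℂ) := by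
    intro α
    rw [AffineHall.hallProd_directSum hδ α hE hdistinct, hmun,
      AffineHall.permChar_eq_assignCount g mu hg α]
    have hv : ((AffineHall.vq k : AffineHall.HallField k) : ℂ)
        = ((Real.sqrt (Fintype.card k) : ℝ) : ℂ) := rfl
    rw [← hv]
    push_cast
    rfl
  constructor
  · rw [AffineHall.permModule_character, ← hcoeff]
    simp only [AffineHall.hallHPart, AffineHall.hallHInt, Nat.cast_nonneg, if_true,
      Int.toNat_natCast]
  · rw [AffineHall.spechtModule_character hlam hlamn, AffineHall.detChar, AffineHall.hallSPart,
      Finsupp.finsetSum_apply, Int.cast_sum, Finset.mul_sum]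
    change algebraMap (AffineHall.HallField k) ℂ _ = _
    rw [map_sum]
    refine Finset.sum_congr rfl fun σ _ => ?_
    rw [Int.cast_mul, mul_left_comm, ← hcoeff (AffineHall.shiftedWeight lam σ), Units.smul_def,
      Finsupp.smul_apply, zsmul_eq_mul, map_mul, map_intCast]
    rfl
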